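/- All functions are complex-valued on $[0,1]$. For $r\in[1,\infty]$ and $k\ge 1$ let $W_r^k$ be the set of functions $g$ such that $g,g',\dots,g^{(k-1)}$ are absolutely continuous on $[0,1]$ and $g^{(k)}\in L_r(0,1)$; $W_r^0=L_r(0,1)$. Let $\mathring W_r^k$ be the set of $g\in W_r^k$ with $g^{(j)}(0)=g^{(j)}(1)=0$ for $0\le j<k$. For $s\in[1,\infty]$ with conjugate exponent $s^*$, let $W_s^{-k}$ be the set of functionals $f$ on $\mathring W_{s^*}^k$ of the form $$(f,\varphi)=(-1)^k\int_0^1\sigma(x)\varphi^{(k)}(x)\,dx\qquad(\varphi\in\mathring W_{s^*}^k)$$ with some $\sigma\in L_s(0,1)$; one then writes $f=\sigma^{(k)}$. Generalized derivatives and products with functions are defined by $(f',\varphi)=-(f,\varphi')$ and $(fy,\varphi)=(f,\varphi y)$. Let $n\ge 0$ be an integer and let $$q_0\in W_1^1,\quad q_0\ne 0 \text{ on } [0,1],\quad \frac1{q_0}\in W_1^1,\qquad q_k\in W_1^{1-k}\ (1\le k\le n),\qquad p_k\in W_1^{-k}\ (0\le k\le n).$$ For $y\in W_\infty^n$ let $$\ell_{2n+1}y=i\sum_{k=0}^{n}\Big((q_ky^{(n-k+1)})^{(n-k)}+(q_ky^{(n-k)})^{(n-k+1)}\Big)+\sum_{k=0}^n(p_ky^{(n-k)})^{(n-k)},$$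 a functional on $\mathring W_1^{n+1}$ (for $k=0$, $y^{(n+1)}$ is the generalized derivative of $y^{(n)}\in L_\infty(0,1)$). **Theorem.** There are a kernel $K(x,t)$, $0\le t\le x\le1$, a bounded linear operator $B$ mapping $L_\infty(0,1)$ bijectively onto itself, functions $u_0,\dots,u_{n-1}\in W_1^1$ and a function $a\in L(0,1)$ such that, for every $x\in[0,1]$, the function $K(x,\cdot)$ is integrable on $[0,x]$, and $$Bf(x)=2iq_0(x)f(x)+\int_0^xK(x,t)f(t)\,dt\quad\text{for a.e. }x\in(0,1)\qquad(f\in L_\infty(0,1)),$$ $$|K(x,t)|\le a(t)\quad(0\le t\le x\le 1),$$ and for every $y\in W_\infty^n$ $$\ell_{2n+1}y=\frac{d^{n+1}}{dx^{n+1}}\big(By^{(n)}+Cy\big),\qquad Cy=\sum_{\nu=0}^{n-1}y^{(\nu)}(0)\,u_\nu(x),$$ as functionals on $\mathring W_1^{n+1}$, i.e. as elements of $W_\infty^{-n-1}$. Moreover, for all $P_0,\dots,P_n,Q_0,\dots,Q_n\in L(0,1)$ with $P_0=p_0$, $Q_0=q_0'$, and $P_k^{(k)}=p_k$, $Q_k^{(k-1)}=q_k$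 for $1\le k\le n$, one has, for almost every $t\in(0,1)$ and all $x\in[t,1]$, $$K(x,t)=\sum_{k=0}^n(-1)^k\frac{(x-t)^k}{k!}\big(P_k(t)-iQ_k(t)\big)+\sum_{k=1}^n\int_t^x\big(P_k(\tau)+iQ_k(\tau)\big)\frac{(\tau-t)^{k-1}}{(k-1)!}\,d\tau$$ $$+\sum_{k=2}^n\sum_{\nu=1}^{k-1}(-1)^\nu\int_t^x\frac{(x-\tau)^\nu}{\nu!}\Big(\tbinom k\nu P_k(\tau)+i\big(\tbinom{k-1}{\nu}-\tbinom{k-1}{\nu-1}\big)Q_k(\tau)\Big)\frac{(\tau-t)^{k-1-\nu}}{(k-1-\nu)!}\,d\tau .$$ -/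

import Mathlib

open MeasureTheory Set
open scoped ENNReal

noncomputable section

namespace OddSingular

/-- Lebesgue measure on the unit interval. -/
abbrev mu : Measure ℝ := volume.restrict (Icc (0 : ℝ) 1)

/-- The space `L_∞(0,1)` of (classes of) complex-valued functions. -/
abbrev Linf : Type := Lp ℂ ∞ mu

/-- The pointwise derivative on `[0,1]` (one-sided at the endpoints); `d^[k] g` is `g^{(k)}`. -/
def d (g : ℝ → ℂ) : ℝ → ℂ := derivWithin g (Icc (0 : ℝ) 1)

/-- `g ∈ W_r^k`: the functions `g, g', …, g^{(k-1)}` are absolutely continuous on `[0,1]` and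
`g^{(k)} ∈ L_r(0,1)`. Only the values of `g` on `[0,1]` matter. In particular `W_r^0 = L_r(0,1)`. -/
def MemW (r : ℝ≥0∞) (k : ℕ) (g : ℝ → ℂ) : Prop :=
  (∀ j < k, AbsolutelyContinuousOnInterval (d^[j] g) 0 1) ∧ MemLp (d^[k] g) r mu

/-- The test functions of order `k`: those `g ∈ W_r^k` with
`g^{(j)}(0) = g^{(j)}(1) = 0` for `j = 0, …, k-1`. -/
def MemTest (r : ℝ≥0∞) (k : ℕ) (g : ℝ → ℂ) : Prop :=
  MemW r k g ∧ ∀ j < k, (d^[j] g) 0 = 0 ∧ (d^[j] g) 1 = 0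

/-- Functionals on test functions. Which space of test functions is meant (and hence on which
arguments the value counts) is recorded by the predicates `IsGenDeriv` and `MemNegW` below;
the values at all other arguments play no role. -/
abbrev Functional : Type := (ℝ → ℂ) → ℂ

/-- The functional `φ ↦ ∫₀¹ g φ` defined by a function `g`. -/
def regular (g : ℝ → ℂ) : Functional := fun φ => ∫ x, g x * φ x ∂mu

/-- The generalized derivative: `(f', φ) = -(f, φ')`; `D^[k] f` is `f^{(k)}`. -/
def D (f : Functional) : Functional := fun φ => -f (d φ)

/-- The product of a functional and a function: `(f y, φ) = (f, φ y)`. -/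
def mulFun (f : Functional) (y : ℝ → ℂ) : Functional := fun φ => f (fun x => φ x * y x)

/-- The functional `f` on the test functions of order `k` (and of the exponent conjugate to `s`)
is the `k`-th generalized derivative of the function `σ`:
`(f, φ) = (-1)^k ∫₀¹ σ φ^{(k)}` for every such test function `φ`. -/
def IsGenDeriv (s : ℝ≥0∞) (k : ℕ) (σ : ℝ → ℂ) (f : Functional) : Prop :=
  ∀ φ : ℝ → ℂ, MemTest s.conjExponent k φ →
    f φ = (-1) ^ k * ∫ x, σ x * (d^[k] φ) x ∂mu

/-- `f ∈ W_s^{-k}`: the functional `f` is the `k`-th generalized derivative of some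
`σ ∈ L_s(0,1)`. -/
def MemNegW (s : ℝ≥0∞) (k : ℕ) (f : Functional) : Prop :=
  ∃ σ : ℝ → ℂ, MemLp σ s mu ∧ IsGenDeriv s k σ f

/-- The conditions on the coefficients: `q_0, 1/q_0 ∈ W_1^1`, `q_k ∈ W_1^{1-k}` for `1 ≤ k ≤ n`
and `p_k ∈ W_1^{-k}` for `0 ≤ k ≤ n`. The coefficient `q_0` is a function and is kept apart from
the functionals `q_1, …, q_n` (`q 0` is not used). -/
structure Coefficients (n : ℕ) (q₀ : ℝ → ℂ) (q p : ℕ → Functional) : Prop where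
  q_zero : MemW 1 1 q₀
  q_zero_ne : ∀ x ∈ Icc (0 : ℝ) 1, q₀ x ≠ 0
  q_zero_inv : MemW 1 1 (fun x => 1 / q₀ x)
  q_mem : ∀ k, 1 ≤ k → k ≤ n → MemNegW 1 (k - 1) (q k)
  p_mem : ∀ k, k ≤ n → MemNegW 1 k (p k)

/-- The singular differential expression of order `2n+1`,
`i ∑_{k=0}^n ((q_k y^{(n-k+1)})^{(n-k)} + (q_k y^{(n-k)})^{(n-k+1)})
  + ∑_{k=0}^n (p_k y^{(n-k)})^{(n-k)}`, for `y ∈ W_∞^n`.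
The terms with `q_0` stand first; there `y^{(n+1)}` is the generalized derivative of `y^{(n)}`. -/
def ell (n : ℕ) (q₀ : ℝ → ℂ) (q p : ℕ → Functional) (y : ℝ → ℂ) : Functional :=
  Complex.I • (D^[n] (mulFun (D (regular (d^[n] y))) q₀)
      + D^[n + 1] (mulFun (regular (d^[n] y)) q₀))
    + Complex.I • (∑ k ∈ Finset.Icc 1 n,
        (D^[n - k] (mulFun (q k) (d^[n - k + 1] y))
          + D^[n - k + 1] (mulFun (q k) (d^[n - k] y))))
    + ∑ k ∈ Finset.range (n + 1), D^[n - k] (mulFun (p k) (d^[n - k] y))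

/-- `P_0, …, P_n` and `Q_0, …, Q_n` are regular primitives of the coefficients: all of them
belong to `L(0,1)`, `P_0 = p_0`, `Q_0 = q_0'`, and `P_k^{(k)} = p_k`, `Q_k^{(k-1)} = q_k`
for `1 ≤ k ≤ n`. -/
structure Primitives (n : ℕ) (q₀ : ℝ → ℂ) (q p : ℕ → Functional) (P Q : ℕ → ℝ → ℂ) : Prop where
  P_mem : ∀ k, k ≤ n → MemLp (P k) 1 mu
  P_deriv : ∀ k, k ≤ n → IsGenDeriv 1 k (P k) (p k)
  Q_zero : Q 0 =ᵐ[mu] d q₀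
  Q_mem : ∀ k, 1 ≤ k → k ≤ n → MemLp (Q k) 1 mu
  Q_deriv : ∀ k, 1 ≤ k → k ≤ n → IsGenDeriv 1 (k - 1) (Q k) (q k)

/-- The explicit kernel built from the primitives of the coefficients. -/
def kernel (n : ℕ) (P Q : ℕ → ℝ → ℂ) (x t : ℝ) : ℂ :=
  (∑ k ∈ Finset.range (n + 1),
      (-1) ^ k * (((x - t : ℝ) : ℂ) ^ k / (k.factorial : ℂ)) * (P k t - Complex.I * Q k t))
    + (∑ k ∈ Finset.Icc 1 n,
        ∫ τ in t..x, (P k τ + Complex.I * Q k τ)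
          * (((τ - t : ℝ) : ℂ) ^ (k - 1) / ((k - 1).factorial : ℂ)))
    + ∑ k ∈ Finset.Icc 2 n, ∑ ν ∈ Finset.Icc 1 (k - 1),
        (-1) ^ ν * ∫ τ in t..x, (((x - τ : ℝ) : ℂ) ^ ν / (ν.factorial : ℂ))
          * ((k.choose ν : ℂ) * P k τ
              + Complex.I * (((k - 1).choose ν : ℂ) - ((k - 1).choose (ν - 1) : ℂ)) * Q k τ)
          * (((τ - t : ℝ) : ℂ) ^ (k - 1 - ν) / ((k - 1 - ν).factorial : ℂ))

end OddSingular

end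

noncomputable section

namespace OddSingular

open Filter Topology

/-! Pair the expression with a test function `φ`. The term with `p_k` becomes `(-1)^n ∫ P_k (φ^(n-k)
y^(n-k))^(k)`, and the Leibniz rule splits it into integrals of `P_k φ^(n-ν) y^(n-k+ν)`, `0 ≤ ν ≤
k`. The two terms with `q_k` enter with opposite signs, so differences of binomial coefficients
appear (`skew`). For `q_0` the product rule isolates the leading part `2i q_0 y^(n) φ^(n+1)` and
leaves a term with `q_0'`. Integrating each remaining product by parts `ν+1` times moves everything
onto `φ^(n+1)`; hence the expression is the derivative of order `n+1` of `2i q_0 y^(n)` plus the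
integral operator `transfer` (`ell_apply`).

Now write `y^(n-j) = J^j y^(n)` plus a Taylor polynomial at `0`. The polynomials produce `C y`, with
`u_ν` the image of a fixed polynomial under `transfer`. In the rest, `J^(ν+1) (c · J^(k-ν) f)` is a
single integral of `f` against a kernel, by Cauchy's formula and Fubini on a triangle
(`transfer_eq_integral_kernel`).

Since `2i q_0` is continuous and has no zeros, `B = 2i q_0 (1 - T)` with `T` of Volterra type. The
kernel is dominated by a summable function of `t`, so the powers of `T` have norm at most `β^m/m!`,
and `1 - T` is invertible (`exists_bijective_volterra`).

The kernel is built from one choice of primitives; the formula for every other choice needs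
uniqueness. For `f` vanishing on `[0,s]` and `y = J^n f`, both choices represent the same
functional, so the difference of the two integral terms annihilates all `φ^(n+1)`. It is zero on
`[0,s]`, hence zero throughout (`ae_eq_zero_of_forall_memTest`). Varying `f` gives equality for
almost every `t` at fixed `x`; rational `x` and continuity in `x` give one null set for all `x`. -/

/-! ### Primitives and absolute continuity on the unit interval -/

/-- `g` is a primitive of the integrable function `h` on `[0,1]`. -/
def IsPrimitive (g h : ℝ → ℂ) : Prop :=
  Integrable h mu ∧ ∀ x ∈ Icc (0 : ℝ) 1, g x = g 0 + ∫ t in (0 : ℝ)..x, h t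

/-- The primitive of a function vanishing at `0`. -/
def J (f : ℝ → ℂ) : ℝ → ℂ := fun x => ∫ t in (0 : ℝ)..x, f t

theorem intervalIntegrable_of_integrable {E : Type*} [NormedAddCommGroup E] {h : ℝ → E}
    (hh : Integrable h mu) {a b : ℝ} (ha : a ∈ Icc (0 : ℝ) 1) (hb : b ∈ Icc (0 : ℝ) 1) :
    IntervalIntegrable h volume a b := by
  have h1 : IntegrableOn h (uIcc a b) :=
    IntegrableOn.mono_set hh (uIcc_subset_Icc ha hb)
  exact h1.intervalIntegrable

theorem integral_mu_eq (h : ℝ → ℂ) : ∫ x, h x ∂mu = ∫ x in (0 : ℝ)..1, h x := by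
  rw [intervalIntegral.integral_of_le zero_le_one, integral_Icc_eq_integral_Ioc]

theorem ae_mu_mem_Icc : ∀ᵐ x ∂mu, x ∈ Icc (0 : ℝ) 1 := ae_restrict_mem measurableSet_Icc

theorem ae_mu_mem_Ioo : ∀ᵐ x ∂mu, x ∈ Ioo (0 : ℝ) 1 := by
  have : mu = volume.restrict (Ioo (0 : ℝ) 1) := restrict_Ioo_eq_restrict_Icc.symm
  rw [this]
  exact ae_restrict_mem measurableSet_Ioo

theorem zero_mem_Icc01 : (0 : ℝ) ∈ Icc (0 : ℝ) 1 := by simp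

theorem one_mem_Icc01 : (1 : ℝ) ∈ Icc (0 : ℝ) 1 := by simp

theorem ae_mu_iff {p : ℝ → Prop} : (∀ᵐ x ∂mu, p x) ↔ ∀ᵐ x : ℝ, x ∈ Icc (0 : ℝ) 1 → p x :=
  ae_restrict_iff' measurableSet_Icc

theorem J_congr_ae {f g : ℝ → ℂ} (h : f =ᵐ[mu] g) : EqOn (J f) (J g) (Icc 0 1) := by
  intro x hx
  refine intervalIntegral.integral_congr_ae ?_
  filter_upwards [ae_mu_iff.1 h] with t ht h1
  rw [uIoc_of_le hx.1] at h1
  exact ht ⟨h1.1.le, h1.2.trans hx.2⟩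

theorem _root_.AbsolutelyContinuousOnInterval.lipschitz_comp {X Y : Type*} [PseudoMetricSpace X]
    [PseudoMetricSpace Y] {f : ℝ → X} {a b : ℝ} {g : X → Y} {C : NNReal} (hg : LipschitzWith C g)
    (hf : AbsolutelyContinuousOnInterval f a b) :
    AbsolutelyContinuousOnInterval (fun x => g (f x)) a b := by
  unfold AbsolutelyContinuousOnInterval at *
  refine squeeze_zero (fun _ => Finset.sum_nonneg fun _ _ => dist_nonneg) (fun t => ?_)
    (by simpa using hf.const_mul (C : ℝ))
  rw [Finset.mul_sum]
  exact Finset.sum_le_sum fun i _ => hg.dist_le_mul _ _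

theorem _root_.AbsolutelyContinuousOnInterval.congr {X : Type*} [PseudoMetricSpace X]
    {f g : ℝ → X} {a b : ℝ} (hf : AbsolutelyContinuousOnInterval f a b)
    (h : EqOn f g (uIcc a b)) : AbsolutelyContinuousOnInterval g a b := by
  rw [absolutelyContinuousOnInterval_iff] at *
  intro ε hε
  obtain ⟨δ, hδ, H⟩ := hf ε hε
  refine ⟨δ, hδ, fun E hE hs => ?_⟩
  convert H E hE hs using 2 with i hi
  rw [h (hE.1 i hi).1, h (hE.1 i hi).2]

theorem absolutelyContinuous_J {h : ℝ → ℂ} (hh : Integrable h mu) :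
    AbsolutelyContinuousOnInterval (J h) 0 1 := by
  have h1 := (intervalIntegrable_of_integrable hh.re zero_mem_Icc01
    one_mem_Icc01).absolutelyContinuousOnInterval_intervalIntegral (c := 0) (by simp)
  have h2 := (intervalIntegrable_of_integrable hh.im zero_mem_Icc01
    one_mem_Icc01).absolutelyContinuousOnInterval_intervalIntegral (c := 0) (by simp)
  have h3 := (h1.lipschitz_comp Complex.isometry_ofReal.lipschitz).add
    ((h2.lipschitz_comp Complex.isometry_ofReal.lipschitz).const_smul Complex.I)
  refine h3.congr fun x hx => ?_
  rw [uIcc_of_le zero_le_one] at hx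
  have hi := intervalIntegrable_of_integrable hh zero_mem_Icc01 hx
  have hre : (J h x).re = ∫ t in (0 : ℝ)..x, (h t).re :=
    (Complex.reCLM.intervalIntegral_comp_comm hi).symm
  have him : (J h x).im = ∫ t in (0 : ℝ)..x, (h t).im :=
    (Complex.imCLM.intervalIntegral_comp_comm hi).symm
  simp only [Pi.add_apply, smul_eq_mul, RCLike.re_eq_complex_re, RCLike.im_eq_complex_im]
  rw [← hre, ← him, mul_comm, Complex.re_add_im]

namespace IsPrimitive

variable {g h f f' g' : ℝ → ℂ}

theorem of_J (hh : Integrable h mu) : IsPrimitive (J h) h :=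
  ⟨hh, fun x _ => by simp [J]⟩

theorem absolutelyContinuous (H : IsPrimitive g h) : AbsolutelyContinuousOnInterval g 0 1 := by
  have hc : AbsolutelyContinuousOnInterval (fun _ : ℝ => g 0) 0 1 :=
    (LipschitzWith.const (α := ℝ) (g 0)).lipschitzOnWith.absolutelyContinuousOnInterval
  refine (hc.add (absolutelyContinuous_J H.1)).congr fun x hx => ?_
  rw [uIcc_of_le zero_le_one] at hx
  exact (H.2 x hx).symm

theorem continuousOn (H : IsPrimitive g h) : ContinuousOn g (Icc 0 1) := by
  have := H.absolutelyContinuous.continuousOn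
  rwa [uIcc_of_le zero_le_one] at this

theorem ae_hasDerivAt (H : IsPrimitive g h) : ∀ᵐ x ∂mu, HasDerivAt g (h x) x := by
  have h1 := (intervalIntegrable_of_integrable H.1 zero_mem_Icc01
    one_mem_Icc01).ae_hasDerivAt_integral
  filter_upwards [ae_mu_mem_Ioo, ae_restrict_of_ae h1] with x hx h2
  have h3 := (h2 (by rw [uIcc_of_le zero_le_one]; exact Ioo_subset_Icc_self hx) 0
    (by simp)).const_add (g 0)
  refine h3.congr_of_eventuallyEq ?_
  filter_upwards [Icc_mem_nhds hx.1 hx.2] with y hy using H.2 y hy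

theorem d_ae_eq (H : IsPrimitive g h) : d g =ᵐ[mu] h := by
  filter_upwards [H.ae_hasDerivAt, ae_mu_mem_Icc] with x hx h1
  exact hx.hasDerivWithinAt.derivWithin (uniqueDiffOn_Icc zero_lt_one x h1)

/-- Continuity of `h` gives the one-sided derivatives at `0` and `1` as well. This matters because
the boundary conditions of test functions read iterated derivatives at the endpoints. -/
theorem d_eqOn (H : IsPrimitive g h) (hh : ContinuousOn h (Icc 0 1)) : EqOn (d g) h (Icc 0 1) := by
  intro x hx
  refine HasDerivWithinAt.derivWithin ?_ (uniqueDiffOn_Icc zero_lt_one x hx)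
  have : Fact (x ∈ Icc (0 : ℝ) 1) := ⟨hx⟩
  have h1 : HasDerivWithinAt (fun u => ∫ t in (0 : ℝ)..u, h t) (h x) (Icc 0 1) x :=
    intervalIntegral.integral_hasDerivWithinAt_right
      (intervalIntegrable_of_integrable H.1 zero_mem_Icc01 hx)
      (hh.stronglyMeasurableAtFilter_nhdsWithin measurableSet_Icc x) (hh x hx)
  exact (h1.const_add (g 0)).congr (fun y hy => H.2 y hy) (H.2 x hx)

/-- The difference `g - J h` is absolutely continuous with derivative zero almost everywhere, hence
constant. -/
theorem of_ac (hg : AbsolutelyContinuousOnInterval g 0 1) (hh : Integrable h mu)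
    (hd : ∀ᵐ x ∂mu, HasDerivAt g (h x) x) : IsPrimitive g h := by
  have h1 := hg.sub (absolutelyContinuous_J hh)
  have h2 : ∀ᵐ x : ℝ, x ∈ uIcc (0 : ℝ) 1 → HasDerivAt (g - J h) 0 x := by
    rw [uIcc_of_le zero_le_one]
    refine ae_mu_iff.1 ?_
    filter_upwards [hd, (of_J hh).ae_hasDerivAt] with x h3 h4
    simpa using h3.sub h4
  obtain ⟨C, hC⟩ := h1.const_of_ae_hasDerivAt_zero h2
  rw [uIcc_of_le zero_le_one] at hC
  refine ⟨hh, fun x hx => ?_⟩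
  have h5 := (hC x hx).trans (hC 0 zero_mem_Icc01).symm
  simp only [Pi.sub_apply, J, intervalIntegral.integral_same, sub_zero] at h5
  linear_combination h5

/-- Absolute continuity implies bounded variation, hence differentiability almost everywhere; at
interior points `d` is the ordinary derivative. -/
theorem of_ac_d (hg : AbsolutelyContinuousOnInterval g 0 1) (hh : Integrable (d g) mu) :
    IsPrimitive g (d g) := by
  refine of_ac hg hh ?_
  have h1 := hg.boundedVariationOn.ae_differentiableAt_of_mem_uIcc
  filter_upwards [ae_mu_mem_Ioo, ae_restrict_of_ae h1] with x hx h2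
  have h3 := (h2 (by rw [uIcc_of_le zero_le_one]; exact Ioo_subset_Icc_self hx)).hasDerivAt
  have h4 : d g x = deriv g x :=
    derivWithin_of_mem_nhds (Icc_mem_nhds hx.1 hx.2)
  rwa [h4]

theorem congr (H : IsPrimitive g h) (hg : EqOn g f (Icc 0 1)) (hh : h =ᵐ[mu] f') :
    IsPrimitive f f' := by
  refine ⟨H.1.congr hh, fun x hx => ?_⟩
  rw [← hg hx, ← hg zero_mem_Icc01, H.2 x hx]
  exact congrArg _ (J_congr_ae hh hx)

theorem integrable_mul_continuousOn (hh : Integrable h mu) (hg : ContinuousOn g (Icc 0 1)) :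
    Integrable (fun x => h x * g x) mu :=
  IntegrableOn.mul_continuousOn hh hg isCompact_Icc

theorem mul (H : IsPrimitive f f') (G : IsPrimitive g g') :
    IsPrimitive (fun x => f x * g x) (fun x => f' x * g x + f x * g' x) := by
  refine of_ac (H.absolutelyContinuous.smul G.absolutelyContinuous) ?_ ?_
  · refine (integrable_mul_continuousOn H.1 G.continuousOn).add ?_
    simpa only [mul_comm] using integrable_mul_continuousOn G.1 H.continuousOn
  · filter_upwards [H.ae_hasDerivAt, G.ae_hasDerivAt] with x h1 h2 using h1.mul h2

theorem add (H : IsPrimitive f f') (G : IsPrimitive g g') :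
    IsPrimitive (fun x => f x + g x) (fun x => f' x + g' x) := by
  refine ⟨H.1.add G.1, fun x hx => ?_⟩
  rw [intervalIntegral.integral_add (intervalIntegrable_of_integrable H.1 zero_mem_Icc01 hx)
    (intervalIntegrable_of_integrable G.1 zero_mem_Icc01 hx)]
  linear_combination H.2 x hx + G.2 x hx

theorem const_mul (c : ℂ) (H : IsPrimitive f f') :
    IsPrimitive (fun x => c * f x) (fun x => c * f' x) := by
  refine ⟨H.1.const_mul c, fun x hx => ?_⟩
  rw [intervalIntegral.integral_const_mul]
  linear_combination c * H.2 x hx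

theorem sum {ι : Type*} (s : Finset ι) {F F' : ι → ℝ → ℂ} (H : ∀ i ∈ s, IsPrimitive (F i) (F' i)) :
    IsPrimitive (fun x => ∑ i ∈ s, F i x) (fun x => ∑ i ∈ s, F' i x) := by
  refine ⟨integrable_finsetSum _ fun i hi => (H i hi).1, fun x hx => ?_⟩
  rw [intervalIntegral.integral_finsetSum fun i hi =>
    intervalIntegrable_of_integrable (H i hi).1 zero_mem_Icc01 hx, ← Finset.sum_add_distrib]
  exact Finset.sum_congr rfl fun i hi => (H i hi).2 x hx

theorem integral_mul_eq_neg (H : IsPrimitive f f') (G : IsPrimitive g g') (h0 : f 0 * g 0 = 0)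
    (h1 : f 1 * g 1 = 0) : ∫ x, f' x * g x ∂mu = -∫ x, f x * g' x ∂mu := by
  have h2 := (H.mul G).2 1 one_mem_Icc01
  have h3 : Integrable (fun x => f x * g' x) mu := by
    simpa only [mul_comm] using integrable_mul_continuousOn G.1 H.continuousOn
  rw [← integral_mu_eq, integral_add (integrable_mul_continuousOn H.1 G.continuousOn) h3] at h2
  linear_combination h1 - h0 - h2

end IsPrimitive

/-! ### Iterated derivatives and the spaces `W_r^k` -/

theorem d_congr {f g : ℝ → ℂ} (h : EqOn f g (Icc 0 1)) : EqOn (d f) (d g) (Icc 0 1) :=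
  fun _ hx => derivWithin_congr h (h hx)

theorem _root_.Set.EqOn.ae_mu_eq {f g : ℝ → ℂ} (h : EqOn f g (Icc 0 1)) : f =ᵐ[mu] g := by
  filter_upwards [ae_mu_mem_Icc] with x hx using h hx

theorem memLp_of_continuousOn {g : ℝ → ℂ} {r : ℝ≥0∞} (hg : ContinuousOn g (Icc 0 1)) :
    MemLp g r mu := by
  obtain ⟨C, hC⟩ := isCompact_Icc.exists_bound_of_continuousOn hg
  exact MemLp.of_bound (hg.aestronglyMeasurable measurableSet_Icc) C
    (by filter_upwards [ae_mu_mem_Icc] with x hx using hC x hx)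

section Chain

variable {G : ℕ → ℝ → ℂ} {g : ℝ → ℂ} {k : ℕ} {r : ℝ≥0∞}

/-- A chain of primitives identifies the iterated derivatives. Below the top the equality holds at
every point, since the next link is itself a primitive and so continuous; at the top it holds only
almost everywhere. -/
theorem iterate_d_eqOn_of_chain (hG : ∀ j < k, IsPrimitive (G j) (G (j + 1)))
    (h0 : EqOn g (G 0) (Icc 0 1)) : ∀ j < k, EqOn (d^[j] g) (G j) (Icc 0 1) := by
  intro j
  induction j with
  | zero => exact fun _ => h0
  | succ j ih =>
    intro hj
    rw [Function.iterate_succ_apply']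
    exact (d_congr (ih (by omega))).trans ((hG j (by omega)).d_eqOn (hG (j + 1) hj).continuousOn)

theorem iterate_d_ae_eq_of_chain (hG : ∀ j < k, IsPrimitive (G j) (G (j + 1)))
    (h0 : EqOn g (G 0) (Icc 0 1)) : d^[k] g =ᵐ[mu] G k := by
  cases k with
  | zero => exact h0.ae_mu_eq
  | succ k =>
    rw [Function.iterate_succ_apply']
    exact (d_congr (iterate_d_eqOn_of_chain hG h0 k (by omega))).ae_mu_eq.trans
      (hG k (by omega)).d_ae_eq

theorem memW_of_chain (hG : ∀ j < k, IsPrimitive (G j) (G (j + 1)))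
    (h0 : EqOn g (G 0) (Icc 0 1)) (hk : MemLp (G k) r mu) : MemW r k g := by
  refine ⟨fun j hj => (hG j hj).absolutelyContinuous.congr ?_,
    hk.ae_eq (iterate_d_ae_eq_of_chain hG h0).symm⟩
  rw [uIcc_of_le zero_le_one]
  exact (iterate_d_eqOn_of_chain hG h0 j hj).symm

end Chain

namespace MemW

variable {g : ℝ → ℂ} {k : ℕ} {r : ℝ≥0∞}

theorem continuousOn (hg : MemW r k g) {j : ℕ} (hj : j < k) :
    ContinuousOn (d^[j] g) (Icc 0 1) := by
  have := (hg.1 j hj).continuousOn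
  rwa [uIcc_of_le zero_le_one] at this

theorem isPrimitive (hg : MemW r k g) (hr : 1 ≤ r) {j : ℕ} (hj : j < k) :
    IsPrimitive (d^[j] g) (d^[j + 1] g) := by
  have h1 : Integrable (d^[j + 1] g) mu := by
    rcases Nat.lt_or_ge (j + 1) k with h | h
    · exact memLp_one_iff_integrable.1 (memLp_of_continuousOn (hg.continuousOn h))
    · obtain rfl : j + 1 = k := by omega
      exact hg.2.integrable hr
  rw [Function.iterate_succ_apply'] at h1 ⊢
  exact IsPrimitive.of_ac_d (hg.1 j hj) h1

theorem shift {m : ℕ} (hg : MemW r (k + m) g) : MemW r k (d^[m] g) := by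
  refine ⟨fun j hj => ?_, ?_⟩
  · rw [← Function.iterate_add_apply]
    exact hg.1 _ (by omega)
  · rw [← Function.iterate_add_apply]
    exact hg.2

theorem lower (hg : MemW r k g) {m : ℕ} (hm : m < k) (s : ℝ≥0∞) : MemW s m g :=
  ⟨fun j hj => hg.1 j (by omega), memLp_of_continuousOn (hg.continuousOn hm)⟩

end MemW

/-! ### The Leibniz rule and products as test functions -/

/-- The `j`-th derivative of a product, by the Leibniz rule. -/
def leibniz (F G : ℕ → ℝ → ℂ) (j : ℕ) (x : ℝ) : ℂ :=
  ∑ a ∈ Finset.HasAntidiagonal.antidiagonal j, (j.choose a.1 : ℂ) * (F a.1 x * G a.2 x)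

theorem isPrimitive_leibniz {F G : ℕ → ℝ → ℂ} {j : ℕ}
    (hF : ∀ i ≤ j, IsPrimitive (F i) (F (i + 1))) (hG : ∀ i ≤ j, IsPrimitive (G i) (G (i + 1))) :
    IsPrimitive (leibniz F G j) (leibniz F G (j + 1)) := by
  have h1 := IsPrimitive.sum (Finset.HasAntidiagonal.antidiagonal j) fun a ha =>
    ((hF a.1 (Finset.HasAntidiagonal.antidiagonal.fst_le ha)).mul
      (hG a.2 (Finset.HasAntidiagonal.antidiagonal.snd_le ha))).const_mul (j.choose a.1 : ℂ)
  refine h1.congr (fun x _ => rfl) (Eventually.of_forall fun x => ?_)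
  have h2 := Finset.sum_antidiagonal_choose_succ_mul (fun a b => F a x * G b x) j
  refine Eq.trans ?_ h2.symm
  rw [← Finset.sum_add_distrib]
  refine Finset.sum_congr rfl fun a ha => ?_
  have h3 : j.choose a.2 = j.choose a.1 := by
    rw [← Finset.HasAntidiagonal.mem_antidiagonal.1 ha, Nat.choose_symm_add]
  rw [h3]
  ring

/-- This makes `φ^(i) y^(j)` an admissible argument of the coefficients. The exponent conjugate to
`1` is `∞`, so the derivative of order `k` must be bounded: `f` has a summable derivative of order
`k+1`, so its lower ones are continuous, and `g` only has to be in `W_∞^k`. The boundary values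
vanish because every Leibniz summand of order below `k` contains a vanishing derivative of `f`. -/
theorem memTest_mul {f g : ℝ → ℂ} {k : ℕ} (hf : MemW 1 (k + 1) f)
    (h0 : ∀ j < k, d^[j] f 0 = 0 ∧ d^[j] f 1 = 0) (hg : MemW ∞ k g) :
    MemTest ∞ k (fun x => f x * g x) ∧
      d^[k] (fun x => f x * g x) =ᵐ[mu] leibniz (fun i => d^[i] f) (fun i => d^[i] g) k := by
  set L := leibniz (fun i => d^[i] f) (fun i => d^[i] g) with hL
  have hc : ∀ j < k, IsPrimitive (L j) (L (j + 1)) := fun j hj =>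
    isPrimitive_leibniz (fun i hi => hf.isPrimitive le_rfl (by omega))
      (fun i hi => hg.isPrimitive le_top (by omega))
  have he : EqOn (fun x => f x * g x) (L 0) (Icc 0 1) := fun x _ => by simp [hL, leibniz]
  have hk : MemLp (L k) ∞ mu := by
    refine memLp_finsetSum _ fun a ha => MemLp.const_mul ?_ _
    have h1 : MemLp (d^[a.1] f) ∞ mu :=
      memLp_of_continuousOn (hf.continuousOn (by have := Finset.HasAntidiagonal.antidiagonal.fst_le ha; omega))
    have h2 : MemLp (d^[a.2] g) ∞ mu := by
      rcases (Finset.HasAntidiagonal.antidiagonal.snd_le ha).lt_or_eq with h | h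
      · exact memLp_of_continuousOn (hg.continuousOn h)
      · rw [h]; exact hg.2
    exact h2.mul h1
  refine ⟨⟨memW_of_chain hc he hk, fun j hj => ?_⟩, iterate_d_ae_eq_of_chain hc he⟩
  have h1 := iterate_d_eqOn_of_chain hc he j hj
  rw [h1 zero_mem_Icc01, h1 one_mem_Icc01]
  constructor
  · refine Finset.sum_eq_zero fun a ha => ?_
    simp [(h0 a.1 ((Finset.HasAntidiagonal.antidiagonal.fst_le ha).trans_lt hj)).1]
  · refine Finset.sum_eq_zero fun a ha => ?_
    simp [(h0 a.1 ((Finset.HasAntidiagonal.antidiagonal.fst_le ha).trans_lt hj)).2]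

/-! ### Repeated integration against test functions -/

theorem continuousOn_J {f : ℝ → ℂ} (hf : Integrable f mu) : ContinuousOn (J f) (Icc 0 1) :=
  (IsPrimitive.of_J hf).continuousOn

theorem integrable_of_continuousOn {f : ℝ → ℂ} (hf : ContinuousOn f (Icc 0 1)) :
    Integrable f mu :=
  memLp_one_iff_integrable.1 (memLp_of_continuousOn hf)

theorem integrable_iterate_J {f : ℝ → ℂ} (hf : Integrable f mu) (m : ℕ) :
    Integrable (J^[m] f) mu := by
  induction m generalizing f with
  | zero => exact hf
  | succ m ih => exact ih (integrable_of_continuousOn (continuousOn_J hf))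

theorem continuousOn_iterate_J {f : ℝ → ℂ} (hf : Integrable f mu) (m : ℕ) :
    ContinuousOn (J^[m + 1] f) (Icc 0 1) := by
  rw [Function.iterate_succ_apply']
  exact continuousOn_J (integrable_iterate_J hf m)

/-- Integration by parts `ν+1` times. The boundary terms vanish at `0` because of `J` and at `1`
because of `φ`. -/
theorem integral_mul_iterate_d {φ f : ℝ → ℂ} {k : ℕ} (hφ : MemTest 1 k φ) (hf : Integrable f mu)
    {ν : ℕ} : ∀ m, m + ν + 1 ≤ k → ∫ x, f x * (d^[m] φ) x ∂mu =
      (-1) ^ (ν + 1) * ∫ x, (J^[ν + 1] f) x * (d^[m + ν + 1] φ) x ∂mu := by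
  induction ν generalizing f with
  | zero =>
    intro m hm
    rw [(IsPrimitive.of_J hf).integral_mul_eq_neg (hφ.1.isPrimitive le_rfl (j := m) (by omega))
      (by simp [J]) (by simp [(hφ.2 m (by omega)).2])]
    simp
  | succ ν ih =>
    intro m hm
    rw [(IsPrimitive.of_J hf).integral_mul_eq_neg (hφ.1.isPrimitive le_rfl (j := m) (by omega))
      (by simp [J]) (by simp [(hφ.2 m (by omega)).2]),
      ih (integrable_of_continuousOn (continuousOn_J hf)) (m + 1) (by omega),
      show m + 1 + ν + 1 = m + (ν + 1) + 1 by ring]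
    simp only [Function.iterate_succ_apply]
    ring

/-! ### Expansion of the differential expression on a test function -/

/-- The weight with which the `k`-th primitive `Q_k` enters the expansion of the expression. -/
def skew : ℕ → ℕ → ℂ
  | 0, _ => -1
  | _ + 1, 0 => 1
  | k + 1, ν + 1 => (k.choose (ν + 1) : ℂ) - (k.choose ν : ℂ)

/-- The coefficient of `φ^{(n-ν)} y^{(n-k+ν)}` in the expansion of the expression. -/
def coef (P Q : ℕ → ℝ → ℂ) (k ν : ℕ) (τ : ℝ) : ℂ :=
  (k.choose ν : ℂ) * P k τ + Complex.I * skew k ν * Q k τ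

/-- The integral operator obtained from the coefficients when all derivatives are transferred to
the left; `Y j` stands for the derivative of order `n - j`. -/
def transfer (n : ℕ) (P Q : ℕ → ℝ → ℂ) (Y : ℕ → ℝ → ℂ) (x : ℝ) : ℂ :=
  ∑ k ∈ Finset.range (n + 1), ∑ ν ∈ Finset.range (k + 1),
    (-1) ^ ν * (J^[ν + 1] fun τ => coef P Q k ν τ * Y (k - ν) τ) x

theorem iterate_D_apply (m : ℕ) (f : Functional) (φ : ℝ → ℂ) :
    (D^[m] f) φ = (-1) ^ m * f (d^[m] φ) := by
  induction m generalizing f with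
  | zero => simp
  | succ m ih =>
    rw [Function.iterate_succ_apply, ih, Function.iterate_succ_apply', D]
    ring

theorem leibniz_eq_sum_range (F G : ℕ → ℝ → ℂ) (k : ℕ) (x : ℝ) :
    leibniz F G k x = ∑ ν ∈ Finset.range (k + 1), (k.choose ν : ℂ) * (F (k - ν) x * G ν x) := by
  rw [leibniz, Finset.Nat.sum_antidiagonal_eq_sum_range_succ_mk, ← Finset.sum_range_reflect]
  refine Finset.sum_congr rfl fun ν hν => ?_
  have h : ν ≤ k := Nat.lt_succ_iff.1 (Finset.mem_range.1 hν)
  simp only [Nat.succ_eq_add_one, Nat.add_sub_cancel, Nat.sub_sub_self h, Nat.choose_symm h]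

/-- The factor `F_(k+1-ν) G_ν` arises from index `ν-1` in the first sum and `ν` in the second, so
its coefficient is `C(k,ν-1) - C(k,ν)`, the negative of `skew (k + 1) ν`. -/
theorem leibniz_sub_leibniz (F G : ℕ → ℝ → ℂ) (k : ℕ) (x : ℝ) :
    leibniz F (fun i => G (i + 1)) k x - leibniz (fun i => F (i + 1)) G k x =
      -∑ ν ∈ Finset.range (k + 2), skew (k + 1) ν * (F (k + 1 - ν) x * G ν x) := by
  have h1 : leibniz (fun i => F (i + 1)) G k x =
      ∑ ν ∈ Finset.range (k + 2), (k.choose ν : ℂ) * (F (k + 1 - ν) x * G ν x) := by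
    rw [Finset.sum_range_succ, Nat.choose_succ_self, leibniz_eq_sum_range]
    simp only [Nat.cast_zero, zero_mul, add_zero]
    refine Finset.sum_congr rfl fun ν hν => ?_
    have h : ν ≤ k := Nat.lt_succ_iff.1 (Finset.mem_range.1 hν)
    rw [Nat.sub_add_comm h]
  rw [h1, leibniz_eq_sum_range, Finset.sum_range_succ' _ (k + 1), Finset.sum_range_succ' _ (k + 1),
    ← sub_sub, ← Finset.sum_sub_distrib, neg_add, ← Finset.sum_neg_distrib, sub_eq_add_neg]
  congr 1
  · refine Finset.sum_congr rfl fun ν _ => ?_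
    simp only [skew, Nat.add_sub_add_right]
    ring
  · simp [skew]

theorem integrable_mul_of_top {f g : ℝ → ℂ} (hf : Integrable f mu) (hg : MemLp g ∞ mu) :
    Integrable (fun x => f x * g x) mu :=
  memLp_one_iff_integrable.1 (hg.mul (memLp_one_iff_integrable.2 hf))

theorem conjExponent_one : (1 : ℝ≥0∞).conjExponent = ∞ := by simp [ENNReal.conjExponent]

theorem conjExponent_top : (∞ : ℝ≥0∞).conjExponent = 1 := by simp [ENNReal.conjExponent]

theorem MemW.memLp_top {k j : ℕ} {g : ℝ → ℂ} (hg : MemW ∞ k g) (hj : j ≤ k) :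
    MemLp (d^[j] g) ∞ mu := by
  rcases hj.lt_or_eq with h | rfl
  · exact memLp_of_continuousOn (hg.continuousOn h)
  · exact hg.2

section Expansion

variable {n : ℕ} {q₀ : ℝ → ℂ} {q p : ℕ → Functional} {P Q : ℕ → ℝ → ℂ} {y φ : ℝ → ℂ}

theorem integrable_triple {F : ℝ → ℂ} (hF : Integrable F mu) (hy : MemW ∞ n y)
    (hφ : MemTest 1 (n + 1) φ) {i j : ℕ} (hi : i ≤ n) (hj : j ≤ n) :
    Integrable (fun x => F x * (d^[i] φ x * d^[j] y x)) mu :=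
  integrable_mul_of_top hF ((hy.memLp_top hj).mul (memLp_of_continuousOn (r := ∞)
    (hφ.1.continuousOn (Nat.lt_succ_of_le hi))))

/-- The signs `(-1)^(n-k)` from the outer derivatives and `(-1)^k` from `p_k = P_k^(k)` combine to
one independent of `k`. -/
theorem p_term_eq {k : ℕ} (hk : k ≤ n) (hP : MemLp (P k) 1 mu) (hp : IsGenDeriv 1 k (P k) (p k))
    (hy : MemW ∞ n y) (hφ : MemTest 1 (n + 1) φ) :
    (D^[n - k] (mulFun (p k) (d^[n - k] y))) φ = (-1) ^ n * ∑ ν ∈ Finset.range (k + 1),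
      (k.choose ν : ℂ) * ∫ x, P k x * (d^[n - ν] φ x * d^[n - (k - ν)] y x) ∂mu := by
  have h1 := memTest_mul (f := d^[n - k] φ) (g := d^[n - k] y) (k := k)
    (MemW.shift (by rw [show k + 1 + (n - k) = n + 1 by omega]; exact hφ.1))
    (fun j hj => by
      rw [← Function.iterate_add_apply]; exact hφ.2 _ (by omega))
    (MemW.shift (by rwa [show k + (n - k) = n by omega]))
  rw [iterate_D_apply, mulFun, hp _ (by rw [conjExponent_one]; exact h1.1), ← mul_assoc, ← pow_add,
    Nat.sub_add_cancel hk]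
  congr 1
  have h2 : ∀ᵐ x ∂mu, P k x * (d^[k] fun x => d^[n - k] φ x * d^[n - k] y x) x =
      ∑ ν ∈ Finset.range (k + 1),
        (k.choose ν : ℂ) * (P k x * (d^[n - ν] φ x * d^[n - (k - ν)] y x)) := by
    filter_upwards [h1.2] with x hx
    rw [hx, leibniz_eq_sum_range, Finset.mul_sum]
    refine Finset.sum_congr rfl fun ν hν => ?_
    have h : ν ≤ k := Nat.lt_succ_iff.1 (Finset.mem_range.1 hν)
    rw [← Function.iterate_add_apply, ← Function.iterate_add_apply,
      show k - ν + (n - k) = n - ν by omega, show ν + (n - k) = n - (k - ν) by omega]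
    ring
  rw [integral_congr_ae h2, integral_finsetSum]
  · simp only [integral_const_mul]
  · intro ν hν
    exact (integrable_triple (memLp_one_iff_integrable.1 hP) hy hφ (by omega)
      (by omega)).const_mul _

/-- The two terms differ by one outer derivative, hence by a sign, so `leibniz_sub_leibniz` applies
to the difference. -/
theorem q_term_eq {k : ℕ} (hk : k + 1 ≤ n) (hQ : MemLp (Q (k + 1)) 1 mu)
    (hq : IsGenDeriv 1 k (Q (k + 1)) (q (k + 1))) (hy : MemW ∞ n y) (hφ : MemTest 1 (n + 1) φ) :
    (D^[n - (k + 1)] (mulFun (q (k + 1)) (d^[n - (k + 1) + 1] y))) φ +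
      (D^[n - (k + 1) + 1] (mulFun (q (k + 1)) (d^[n - (k + 1)] y))) φ =
    (-1) ^ n * ∑ ν ∈ Finset.range (k + 2), skew (k + 1) ν *
      ∫ x, Q (k + 1) x * (d^[n - ν] φ x * d^[n - (k + 1 - ν)] y x) ∂mu := by
  obtain ⟨m, rfl⟩ := Nat.exists_eq_add_of_le' hk
  simp only [Nat.add_sub_cancel]
  have h1 := memTest_mul (f := d^[m] φ) (g := d^[m + 1] y) (k := k)
    (MemW.shift (hφ.1.lower (by omega) 1))
    (fun j hj => by
      rw [← Function.iterate_add_apply]; exact hφ.2 _ (by omega))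
    (MemW.shift (by rwa [show k + (m + 1) = m + (k + 1) by omega]))
  have h2 := memTest_mul (f := d^[m + 1] φ) (g := d^[m] y) (k := k)
    (MemW.shift (by rw [show k + 1 + (m + 1) = m + (k + 1) + 1 by omega]; exact hφ.1))
    (fun j hj => by
      rw [← Function.iterate_add_apply]; exact hφ.2 _ (by omega))
    (MemW.shift (hy.lower (by omega) ∞))
  have hQ1 := memLp_one_iff_integrable.1 hQ
  rw [iterate_D_apply, iterate_D_apply, mulFun, mulFun,
    hq _ (by rw [conjExponent_one]; exact h1.1), hq _ (by rw [conjExponent_one]; exact h2.1)]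
  have h3 : ∀ᵐ x ∂mu, Q (k + 1) x * (d^[k] fun x => d^[m] φ x * d^[m + 1] y x) x -
      Q (k + 1) x * (d^[k] fun x => d^[m + 1] φ x * d^[m] y x) x =
      -∑ ν ∈ Finset.range (k + 2), skew (k + 1) ν *
        (Q (k + 1) x * (d^[m + (k + 1) - ν] φ x * d^[m + (k + 1) - (k + 1 - ν)] y x)) := by
    filter_upwards [h1.2, h2.2] with x hx hx'
    have h4 := leibniz_sub_leibniz (fun i => d^[i + m] φ) (fun i => d^[i + m] y) k x
    have e1 : ∀ ψ : ℝ → ℂ, (fun i => d^[i] (d^[m] ψ)) = fun i => d^[i + m] ψ := fun ψ =>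
      funext fun i => (Function.iterate_add_apply d i m ψ).symm
    have e2 : ∀ ψ : ℝ → ℂ, (fun i => d^[i] (d^[m + 1] ψ)) = fun i => d^[i + 1 + m] ψ := fun ψ =>
      funext fun i => by rw [← Function.iterate_add_apply, add_right_comm, add_assoc]
    rw [hx, hx', ← mul_sub, e1, e1, e2, e2, h4, mul_neg, Finset.mul_sum]
    refine congrArg _ (Finset.sum_congr rfl fun ν hν => ?_)
    have h : ν ≤ k + 1 := Nat.lt_succ_iff.1 (Finset.mem_range.1 hν)
    rw [show k + 1 - ν + m = k + m + 1 - ν by omega, show ν + m = k + m + 1 - (k + 1 - ν) by omega,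
      show m + (k + 1) = k + m + 1 by omega]
    ring
  have h5 := integral_congr_ae h3
  rw [integral_sub (integrable_mul_of_top hQ1 (h1.1.1.2))
    (integrable_mul_of_top hQ1 (h2.1.1.2)), integral_neg, integral_finsetSum] at h5
  · simp only [integral_const_mul] at h5
    have h6 : (-1 : ℂ) ^ (k * 2) = 1 := by simp [pow_mul']
    linear_combination (-1) ^ (m + k) * h5
  · intro ν hν
    exact (integrable_triple hQ1 hy hφ (by omega) (by omega)).const_mul _

/-- Only the first term needs the product rule, for `(φ^(n) q_0)'`. Its part with `q_0'` carries a
minus sign, which is why `skew 0 0 = -1`; the part with `q_0` doubles the second term. -/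
theorem q_zero_term_eq (hq : MemW 1 1 q₀) (hQ : Q 0 =ᵐ[mu] d q₀) (hy : MemW ∞ n y)
    (hφ : MemTest 1 (n + 1) φ) :
    (D^[n] (mulFun (D (regular (d^[n] y))) q₀)) φ + (D^[n + 1] (mulFun (regular (d^[n] y)) q₀)) φ =
    (-1) ^ (n + 1) * ∫ x, 2 * q₀ x * d^[n] y x * d^[n + 1] φ x ∂mu +
      (-1) ^ n * -∫ x, Q 0 x * (d^[n] φ x * d^[n] y x) ∂mu := by
  have hq1 : IsPrimitive q₀ (d q₀) := hq.isPrimitive le_rfl (j := 0) zero_lt_one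
  have h1 := ((hφ.1.isPrimitive le_rfl (Nat.lt_succ_self n)).mul hq1).d_ae_eq
  have hQ1 : Integrable (Q 0) mu := hq1.1.congr hQ.symm
  rw [iterate_D_apply, iterate_D_apply, mulFun, mulFun, D]
  simp only [regular]
  have hi : Integrable (fun x => d^[n] y x * (d^[n + 1] φ x * q₀ x)) mu := by
    refine (integrable_mul_of_top (IsPrimitive.integrable_mul_continuousOn
      (hφ.1.isPrimitive le_rfl (Nat.lt_succ_self n)).1 hq1.continuousOn) hy.2).congr
      (Eventually.of_forall fun x => ?_)
    simp only; ring
  have hT := integrable_triple hQ1 hy hφ le_rfl le_rfl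
  have h2 : ∫ x, d^[n] y x * d (fun x => d^[n] φ x * q₀ x) x ∂mu =
      ∫ x, d^[n] y x * (d^[n + 1] φ x * q₀ x) ∂mu +
        ∫ x, Q 0 x * (d^[n] φ x * d^[n] y x) ∂mu := by
    rw [← integral_add hi hT]
    refine integral_congr_ae ?_
    filter_upwards [h1, hQ] with x hx hx'
    rw [hx, hx']
    ring
  have h3 : ∫ x, 2 * q₀ x * d^[n] y x * d^[n + 1] φ x ∂mu =
      2 * ∫ x, d^[n] y x * (d^[n + 1] φ x * q₀ x) ∂mu := by
    rw [← integral_const_mul]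
    refine integral_congr_ae (Eventually.of_forall fun x => ?_)
    simp only; ring
  rw [h2, h3]
  ring

theorem Primitives.integrable_P (hPQ : Primitives n q₀ q p P Q) {k : ℕ} (hk : k ≤ n) :
    Integrable (P k) mu :=
  memLp_one_iff_integrable.1 (hPQ.P_mem k hk)

theorem Primitives.integrable_Q (hPQ : Primitives n q₀ q p P Q) (hq : MemW 1 1 q₀) {k : ℕ}
    (hk : k ≤ n) : Integrable (Q k) mu := by
  cases k with
  | zero => exact (hq.isPrimitive le_rfl (j := 0) zero_lt_one).1.congr hPQ.Q_zero.symm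
  | succ k => exact memLp_one_iff_integrable.1 (hPQ.Q_mem (k + 1) (by omega) hk)

theorem Primitives.integrable_coef (hPQ : Primitives n q₀ q p P Q) (hq : MemW 1 1 q₀) {k : ℕ}
    (hk : k ≤ n) (ν : ℕ) : Integrable (coef P Q k ν) mu :=
  ((hPQ.integrable_P hk).const_mul _).add ((hPQ.integrable_Q hq hk).const_mul _)

theorem ell_apply_eq_sum (hq : MemW 1 1 q₀) (hPQ : Primitives n q₀ q p P Q) (hy : MemW ∞ n y)
    (hφ : MemTest 1 (n + 1) φ) :
    ell n q₀ q p y φ =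
      (-1) ^ (n + 1) * ∫ x, 2 * Complex.I * q₀ x * d^[n] y x * d^[n + 1] φ x ∂mu +
      (-1) ^ n * ∑ k ∈ Finset.range (n + 1), ∑ ν ∈ Finset.range (k + 1),
        ∫ x, coef P Q k ν x * d^[n - (k - ν)] y x * d^[n - ν] φ x ∂mu := by
  have h0 := q_zero_term_eq hq hPQ.Q_zero hy hφ
  have hp : ∀ k ∈ Finset.range (n + 1), _ := fun k hk =>
    p_term_eq (Nat.lt_succ_iff.1 (Finset.mem_range.1 hk))
      (hPQ.P_mem k (Nat.lt_succ_iff.1 (Finset.mem_range.1 hk)))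
      (hPQ.P_deriv k (Nat.lt_succ_iff.1 (Finset.mem_range.1 hk))) hy hφ
  have hqk : ∀ k ∈ Finset.range n, _ := fun k hk =>
    q_term_eq (Finset.mem_range.1 hk) (hPQ.Q_mem (k + 1) (by omega) (Finset.mem_range.1 hk))
      (hPQ.Q_deriv (k + 1) (by omega) (Finset.mem_range.1 hk)) hy hφ
  have hI : Finset.Icc 1 n = Finset.Ico (0 + 1) (n + 1) := rfl
  simp only [ell, Pi.add_apply, Pi.smul_apply, Finset.sum_apply, smul_eq_mul]
  rw [h0, Finset.sum_congr rfl hp, hI, ← Finset.sum_Ico_add' _ 0 n 1, Nat.Ico_zero_eq_range,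
    Finset.sum_congr rfl hqk]
  have hlead : ∫ x, 2 * Complex.I * q₀ x * d^[n] y x * d^[n + 1] φ x ∂mu =
      Complex.I * ∫ x, 2 * q₀ x * d^[n] y x * d^[n + 1] φ x ∂mu := by
    rw [← integral_const_mul]
    refine integral_congr_ae (Eventually.of_forall fun x => ?_)
    simp only; ring
  have hsplit : ∀ k ∈ Finset.range (n + 1), ∑ ν ∈ Finset.range (k + 1),
      ∫ x, coef P Q k ν x * d^[n - (k - ν)] y x * d^[n - ν] φ x ∂mu =
      (∑ ν ∈ Finset.range (k + 1),
        (k.choose ν : ℂ) * ∫ x, P k x * (d^[n - ν] φ x * d^[n - (k - ν)] y x) ∂mu) +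
      Complex.I * ∑ ν ∈ Finset.range (k + 1), skew k ν *
        ∫ x, Q k x * (d^[n - ν] φ x * d^[n - (k - ν)] y x) ∂mu := by
    intro k hk
    have hk' := Nat.lt_succ_iff.1 (Finset.mem_range.1 hk)
    rw [Finset.mul_sum, ← Finset.sum_add_distrib]
    refine Finset.sum_congr rfl fun ν _ => ?_
    rw [← mul_assoc, ← integral_const_mul, ← integral_const_mul, ← integral_add
      ((integrable_triple (hPQ.integrable_P hk') hy hφ (by omega) (by omega)).const_mul _)
      ((integrable_triple (hPQ.integrable_Q hq hk') hy hφ (by omega) (by omega)).const_mul _)]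
    refine integral_congr_ae (Eventually.of_forall fun x => ?_)
    simp only [coef]; ring
  rw [hlead, Finset.sum_congr rfl hsplit, Finset.sum_add_distrib, ← Finset.mul_sum,
    ← Finset.mul_sum, ← Finset.mul_sum,
    Finset.sum_range_succ' (fun k => ∑ ν ∈ Finset.range (k + 1), skew k ν *
        ∫ x, Q k x * (d^[n - ν] φ x * d^[n - (k - ν)] y x) ∂mu)]
  simp only [zero_add, Finset.sum_range_one, skew, Nat.sub_zero, Nat.sub_self]
  ring

/-- The summand containing `φ^(n-ν)` needs exactly `ν+1` integrations by parts to reach `φ^(n+1)`.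
They contribute `(-1)^(ν+1)`, which leaves the sign `(-1)^ν` in `transfer` after the common
`(-1)^(n+1)` is taken out. -/
theorem ell_apply (hq : MemW 1 1 q₀) (hPQ : Primitives n q₀ q p P Q) (hy : MemW ∞ n y)
    (hφ : MemTest 1 (n + 1) φ) :
    ell n q₀ q p y φ = (-1) ^ (n + 1) * ∫ x, (2 * Complex.I * q₀ x * d^[n] y x +
      transfer n P Q (fun j => d^[n - j] y) x) * d^[n + 1] φ x ∂mu := by
  have hint : ∀ k ∈ Finset.range (n + 1), ∀ ν, Integrable
      (fun τ => coef P Q k ν τ * d^[n - (k - ν)] y τ) mu := fun k hk ν =>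
    integrable_mul_of_top (hPQ.integrable_coef hq (Nat.lt_succ_iff.1 (Finset.mem_range.1 hk)) ν)
      (hy.memLp_top (by omega))
  have hφ1 : Integrable (d^[n + 1] φ) mu := memLp_one_iff_integrable.1 hφ.1.2
  have hJ : ∀ k ∈ Finset.range (n + 1), ∀ ν, Integrable (fun x => (-1) ^ ν *
      ((J^[ν + 1] fun τ => coef P Q k ν τ * d^[n - (k - ν)] y τ) x * d^[n + 1] φ x)) mu := by
    intro k hk ν
    refine Integrable.const_mul ?_ _
    simpa only [mul_comm] using IsPrimitive.integrable_mul_continuousOn hφ1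
      (continuousOn_iterate_J (hint k hk ν) ν)
  have hq1 : IsPrimitive q₀ (d q₀) := hq.isPrimitive le_rfl (j := 0) zero_lt_one
  have hlead : Integrable (fun x => 2 * Complex.I * q₀ x * d^[n] y x * d^[n + 1] φ x) mu := by
    refine ((integrable_mul_of_top (IsPrimitive.integrable_mul_continuousOn
      hφ1 hq1.continuousOn) hy.2).const_mul (2 * Complex.I)).congr
      (Eventually.of_forall fun x => ?_)
    simp only; ring
  rw [ell_apply_eq_sum hq hPQ hy hφ]
  have h1 : ∀ x, (2 * Complex.I * q₀ x * d^[n] y x +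
      transfer n P Q (fun j => d^[n - j] y) x) * d^[n + 1] φ x =
      2 * Complex.I * q₀ x * d^[n] y x * d^[n + 1] φ x +
      ∑ k ∈ Finset.range (n + 1), ∑ ν ∈ Finset.range (k + 1), (-1) ^ ν *
        ((J^[ν + 1] fun τ => coef P Q k ν τ * d^[n - (k - ν)] y τ) x * d^[n + 1] φ x) := by
    intro x
    simp only [transfer, add_mul, Finset.sum_mul, mul_assoc]
  simp only [h1]
  rw [integral_add hlead (integrable_finsetSum _ fun k hk => integrable_finsetSum _ fun ν _ =>
    hJ k hk ν), integral_finsetSum _ fun k hk => integrable_finsetSum _ fun ν _ => hJ k hk ν,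
    mul_add, Finset.mul_sum, Finset.mul_sum]
  congr 1
  refine Finset.sum_congr rfl fun k hk => ?_
  rw [integral_finsetSum _ fun ν _ => hJ k hk ν, Finset.mul_sum, Finset.mul_sum]
  refine Finset.sum_congr rfl fun ν hν => ?_
  have h : ν ≤ n := by
    have := Finset.mem_range.1 hν
    have := Finset.mem_range.1 hk
    omega
  rw [integral_mul_iterate_d (ν := ν) hφ (hint k hk ν) (n - ν) (by omega), integral_const_mul,
    Nat.sub_add_cancel h]
  ring

end Expansion

/-! ### Linearity and regularity of the integral operators -/

section IterateJ

variable {f g : ℝ → ℂ}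

theorem iterate_J_congr (h : EqOn f g (Icc 0 1)) (m : ℕ) :
    EqOn (J^[m] f) (J^[m] g) (Icc 0 1) := by
  induction m generalizing f g with
  | zero => exact h
  | succ m ih => exact ih (J_congr_ae h.ae_mu_eq)

theorem iterate_J_congr_ae (h : f =ᵐ[mu] g) (m : ℕ) :
    EqOn (J^[m + 1] f) (J^[m + 1] g) (Icc 0 1) :=
  iterate_J_congr (J_congr_ae h) m

theorem iterate_J_add (hf : Integrable f mu) (hg : Integrable g mu) (m : ℕ) :
    EqOn (J^[m] fun x => f x + g x) (fun x => (J^[m] f) x + (J^[m] g) x) (Icc 0 1) := by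
  induction m generalizing f g with
  | zero => exact fun _ _ => rfl
  | succ m ih =>
    refine EqOn.trans (iterate_J_congr (g := fun x => J f x + J g x) (fun x hx => ?_) m)
      (ih (integrable_iterate_J hf 1) (integrable_iterate_J hg 1))
    exact intervalIntegral.integral_add (intervalIntegrable_of_integrable hf zero_mem_Icc01 hx)
      (intervalIntegrable_of_integrable hg zero_mem_Icc01 hx)

theorem iterate_J_const_mul (c : ℂ) (f : ℝ → ℂ) (m : ℕ) :
    (J^[m] fun x => c * f x) = fun x => c * (J^[m] f) x := by
  induction m generalizing f with
  | zero => rfl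
  | succ m ih =>
    have h : (J fun x => c * f x) = fun x => c * J f x :=
      funext fun x => intervalIntegral.integral_const_mul _ _
    rw [Function.iterate_succ_apply, h, ih, Function.iterate_succ_apply]

theorem memLp_iterate_J (hf : MemLp f ∞ mu) (m : ℕ) : MemLp (J^[m] f) ∞ mu := by
  cases m with
  | zero => exact hf
  | succ m => exact memLp_of_continuousOn (continuousOn_iterate_J (hf.integrable le_top) m)

theorem isPrimitive_iterate_J (hf : Integrable f mu) (m : ℕ) :
    IsPrimitive (J^[m + 1] f) (J^[m] f) := by
  rw [Function.iterate_succ_apply']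
  exact IsPrimitive.of_J (integrable_iterate_J hf m)

/-- Every bounded `f` is thus `y^(n)` for a `y` with zero initial data; the uniqueness argument uses
this `y`. -/
theorem memW_iterate_J (hf : MemLp f ∞ mu) (n : ℕ) :
    MemW ∞ n (J^[n] f) ∧ ∀ j ≤ n, d^[n - j] (J^[n] f) =ᵐ[mu] J^[j] f := by
  have h1 : ∀ i < n, IsPrimitive (J^[n - i] f) (J^[n - (i + 1)] f) := fun i hi => by
    have := isPrimitive_iterate_J (hf.integrable le_top) (n - (i + 1))
    rwa [show n - (i + 1) + 1 = n - i by omega] at this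
  refine ⟨memW_of_chain (G := fun i => J^[n - i] f) h1 (fun _ _ => rfl)
    (memLp_iterate_J hf _), fun j hj => ?_⟩
  have h2 := iterate_d_ae_eq_of_chain (k := n - j) (g := J^[n] f) (G := fun i => J^[n - i] f)
    (fun i hi => h1 i (by omega)) (fun _ _ => rfl)
  simpa only [Nat.sub_sub_self hj] using h2

end IterateJ

section Transfer

variable {n : ℕ} {P Q : ℕ → ℝ → ℂ} {Y Z : ℕ → ℝ → ℂ}

theorem transfer_congr_ae (h : ∀ j ≤ n, Y j =ᵐ[mu] Z j) :
    EqOn (transfer n P Q Y) (transfer n P Q Z) (Icc 0 1) := by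
  intro x hx
  refine Finset.sum_congr rfl fun k hk => Finset.sum_congr rfl fun ν _ => ?_
  have := Finset.mem_range.1 hk
  refine congrArg _ (iterate_J_congr_ae ?_ ν hx)
  filter_upwards [h (k - ν) (by omega)] with τ hτ
  rw [hτ]

theorem transfer_add (hc : ∀ k ≤ n, ∀ ν, Integrable (coef P Q k ν) mu)
    (hY : ∀ j ≤ n, MemLp (Y j) ∞ mu) (hZ : ∀ j ≤ n, MemLp (Z j) ∞ mu) {x : ℝ}
    (hx : x ∈ Icc (0 : ℝ) 1) :
    transfer n P Q (fun j τ => Y j τ + Z j τ) x = transfer n P Q Y x + transfer n P Q Z x := by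
  simp only [transfer]
  rw [← Finset.sum_add_distrib]
  refine Finset.sum_congr rfl fun k hk => ?_
  rw [← Finset.sum_add_distrib]
  refine Finset.sum_congr rfl fun ν _ => ?_
  have hk' : k ≤ n := Nat.lt_succ_iff.1 (Finset.mem_range.1 hk)
  simp only [mul_add]
  rw [iterate_J_add (integrable_mul_of_top (hc k hk' ν) (hY _ (by omega)))
    (integrable_mul_of_top (hc k hk' ν) (hZ _ (by omega))) _ hx]
  ring

theorem transfer_const_mul (c : ℂ) (x : ℝ) :
    transfer n P Q (fun j τ => c * Y j τ) x = c * transfer n P Q Y x := by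
  simp only [transfer, Finset.mul_sum]
  refine Finset.sum_congr rfl fun k _ => Finset.sum_congr rfl fun ν _ => ?_
  simp only [mul_left_comm _ c]
  rw [iterate_J_const_mul]
  exact mul_left_comm _ _ _

theorem transfer_sum {ι : Type*} (s : Finset ι) (c : ι → ℂ) {E : ι → ℕ → ℝ → ℂ}
    (hc : ∀ k ≤ n, ∀ ν, Integrable (coef P Q k ν) mu) (hE : ∀ i, ∀ j ≤ n, MemLp (E i j) ∞ mu)
    {x : ℝ} (hx : x ∈ Icc (0 : ℝ) 1) :
    transfer n P Q (fun j τ => ∑ i ∈ s, c i * E i j τ) x =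
      ∑ i ∈ s, c i * transfer n P Q (E i) x := by
  classical
  induction s using Finset.induction_on with
  | empty => simpa using transfer_const_mul (n := n) (P := P) (Q := Q) (Y := fun _ _ => 0) 0 x
  | insert a s ha ih =>
    simp only [Finset.sum_insert ha]
    rw [transfer_add (Y := fun j τ => c a * E a j τ) hc (fun j hj => (hE a j hj).const_mul _)
      (fun j hj => memLp_finsetSum _ fun i _ => (hE i j hj).const_mul _) hx, transfer_const_mul, ih]

/-- Each summand carries at least one `J`. This puts the `u_ν` in `W_1^1` and makes the Volterra
integral continuous in `x`. -/
theorem isPrimitive_transfer (hc : ∀ k ≤ n, ∀ ν, Integrable (coef P Q k ν) mu)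
    (hY : ∀ j ≤ n, MemLp (Y j) ∞ mu) :
    IsPrimitive (transfer n P Q Y) (fun x => ∑ k ∈ Finset.range (n + 1),
      ∑ ν ∈ Finset.range (k + 1), (-1) ^ ν * (J^[ν] fun τ => coef P Q k ν τ * Y (k - ν) τ) x) :=
  IsPrimitive.sum _ fun k hk => IsPrimitive.sum _ fun ν _ => (isPrimitive_iterate_J
    (integrable_mul_of_top (hc k (Nat.lt_succ_iff.1 (Finset.mem_range.1 hk)) ν)
      (hY _ ((Nat.sub_le _ _).trans (Nat.lt_succ_iff.1 (Finset.mem_range.1 hk))))) ν).const_mul _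

end Transfer

theorem IsPrimitive.memW {g h : ℝ → ℂ} (H : IsPrimitive g h) : MemW 1 1 g :=
  memW_of_chain (G := fun j => if j = 0 then g else h)
    (fun j hj => by obtain rfl : j = 0 := by omega
                    simpa using H) (fun _ _ => by simp)
    (by simpa using memLp_one_iff_integrable.2 H.1)

/-! ### Taylor expansion at `0` and the operator `C` -/

/-- The polynomial multiplying `y^{(μ)}(0)` in the Taylor expansion of `y^{(n-j)}`. -/
def taylorPoly (n : ℕ) (μ : ℕ) : ℕ → ℝ → ℂ
  | 0 => 0
  | j + 1 => fun x => (if μ = n - (j + 1) then 1 else 0) + J (taylorPoly n μ j) x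

theorem continuousOn_taylorPoly (n μ j : ℕ) : ContinuousOn (taylorPoly n μ j) (Icc 0 1) := by
  induction j with
  | zero => exact continuousOn_const
  | succ j ih => exact continuousOn_const.add (continuousOn_J (integrable_of_continuousOn ih))

theorem memLp_taylorPoly (n μ j : ℕ) : MemLp (taylorPoly n μ j) ∞ mu :=
  memLp_of_continuousOn (continuousOn_taylorPoly n μ j)

theorem MemW.taylor_expansion {n : ℕ} {y : ℝ → ℂ} (hy : MemW ∞ n y) {j : ℕ} (hj : j ≤ n) :
    EqOn (d^[n - j] y) (fun x => (J^[j] (d^[n] y)) x +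
      ∑ μ ∈ Finset.range n, d^[μ] y 0 * taylorPoly n μ j x) (Icc 0 1) := by
  induction j with
  | zero => exact fun x _ => by simp [taylorPoly]
  | succ j ih =>
    intro x hx
    have h1 := (hy.isPrimitive le_top (j := n - (j + 1)) (by omega)).2 x hx
    rw [show n - (j + 1) + 1 = n - j by omega] at h1
    have hf : Integrable (d^[n] y) mu := hy.2.integrable le_top
    have h2 := J_congr_ae (ih (by omega)).ae_mu_eq hx
    have hi : ∀ μ, IntervalIntegrable (fun x => d^[μ] y 0 * taylorPoly n μ j x) volume 0 x :=
      fun μ => intervalIntegrable_of_integrable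
        (((memLp_taylorPoly n μ j).integrable le_top).const_mul _) zero_mem_Icc01 hx
    have h3 : J (fun x => (J^[j] (d^[n] y)) x +
        ∑ μ ∈ Finset.range n, d^[μ] y 0 * taylorPoly n μ j x) x =
        (J^[j + 1] (d^[n] y)) x + ∑ μ ∈ Finset.range n, d^[μ] y 0 * J (taylorPoly n μ j) x := by
      rw [J, intervalIntegral.integral_add (intervalIntegrable_of_integrable
        (integrable_iterate_J hf j) zero_mem_Icc01 hx) (by
          simpa only [Finset.sum_fn] using IntervalIntegrable.sum (Finset.range n)
            fun μ _ => hi μ), intervalIntegral.integral_finsetSum fun μ _ => hi μ,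
        Function.iterate_succ_apply']
      simp only [intervalIntegral.integral_const_mul, J]
    rw [h1]
    refine (congrArg _ (h2.trans h3)).trans ?_
    simp only [taylorPoly, mul_add, Finset.sum_add_distrib, mul_ite, mul_one, mul_zero]
    rw [Finset.sum_ite_eq' (Finset.range n), if_pos (Finset.mem_range.2 (by omega))]
    ring

theorem transfer_eq_add_initial {n : ℕ} {P Q : ℕ → ℝ → ℂ} {y : ℝ → ℂ}
    (hc : ∀ k ≤ n, ∀ ν, Integrable (coef P Q k ν) mu) (hy : MemW ∞ n y) {x : ℝ}
    (hx : x ∈ Icc (0 : ℝ) 1) :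
    transfer n P Q (fun j => d^[n - j] y) x = transfer n P Q (fun j => J^[j] (d^[n] y)) x +
      ∑ μ ∈ Finset.range n, d^[μ] y 0 * transfer n P Q (taylorPoly n μ) x := by
  rw [transfer_congr_ae (fun j hj => (hy.taylor_expansion hj).ae_mu_eq) hx,
    transfer_add hc (fun j _ => memLp_iterate_J hy.2 j)
      (fun j _ => memLp_finsetSum _ fun μ _ => (memLp_taylorPoly n μ j).const_mul _) hx,
    transfer_sum _ _ hc (fun μ j _ => memLp_taylorPoly n μ j) hx]

/-! ### Fubini on a triangle and Cauchy's formula -/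

theorem integrable_triangle {F f : ℝ → ℂ} {w : ℝ → ℝ → ℂ} {x : ℝ}
    (hF : IntegrableOn F (Ioc 0 x)) (hf : IntegrableOn f (Ioc 0 x))
    (hw : Continuous (Function.uncurry w)) :
    Integrable (fun z : ℝ × ℝ => {z : ℝ × ℝ | z.2 ≤ z.1}.indicator
      (fun z => F z.1 * w z.1 z.2 * f z.2) z)
      ((volume.restrict (Ioc 0 x)).prod (volume.restrict (Ioc 0 x))) := by
  have hm : MeasurableSet {z : ℝ × ℝ | z.2 ≤ z.1} := measurableSet_le measurable_snd measurable_fst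
  refine Integrable.indicator ?_ hm
  obtain ⟨C, hC⟩ := (isCompact_Icc (a := (0 : ℝ)) (b := x)).prod (isCompact_Icc (a := (0 : ℝ))
    (b := x)) |>.exists_bound_of_continuousOn hw.continuousOn
  have h1 : Integrable (fun z : ℝ × ℝ => F z.1 * f z.2)
      ((volume.restrict (Ioc 0 x)).prod (volume.restrict (Ioc 0 x))) := hF.mul_prod hf
  refine (h1.bdd_mul (c := C) hw.aestronglyMeasurable ?_).congr
    (Eventually.of_forall fun z => ?_)
  · rw [Measure.prod_restrict]
    filter_upwards [ae_restrict_mem (measurableSet_Ioc.prod measurableSet_Ioc)] with z hz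
    exact hC z ⟨Ioc_subset_Icc_self hz.1, Ioc_subset_Icc_self hz.2⟩
  · simp only [Function.uncurry]
    ring

theorem setIntegral_triangle_fst {F f : ℝ → ℂ} {w : ℝ → ℝ → ℂ} {x t : ℝ} (ht : t ∈ Ioc 0 x) :
    ∫ τ in Ioc 0 x, {z : ℝ × ℝ | z.2 ≤ z.1}.indicator
      (fun z => F z.1 * w z.1 z.2 * f z.2) (τ, t) = (∫ τ in t..x, F τ * w τ t) * f t := by
  have h1 : ∀ τ, {z : ℝ × ℝ | z.2 ≤ z.1}.indicator (fun z => F z.1 * w z.1 z.2 * f z.2) (τ, t) =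
      (Ici t).indicator (fun τ => F τ * w τ t * f t) τ := fun τ => rfl
  have h2 : Ioc 0 x ∩ Ici t = Icc t x := by
    ext τ
    simp only [mem_inter_iff, mem_Ioc, mem_Ici, mem_Icc]
    exact ⟨fun h => ⟨h.2, h.1.2⟩, fun h => ⟨⟨ht.1.trans_le h.1, h.2⟩, h.1⟩⟩
  simp only [h1]
  rw [setIntegral_indicator measurableSet_Ici, h2, integral_Icc_eq_integral_Ioc,
    integral_mul_const, intervalIntegral.integral_of_le ht.2]

theorem setIntegral_triangle_snd {F f : ℝ → ℂ} {w : ℝ → ℝ → ℂ} {x τ : ℝ} (hτ : τ ∈ Ioc 0 x) :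
    ∫ t in Ioc 0 x, {z : ℝ × ℝ | z.2 ≤ z.1}.indicator
      (fun z => F z.1 * w z.1 z.2 * f z.2) (τ, t) = F τ * ∫ t in 0..τ, w τ t * f t := by
  have h1 : ∀ t, {z : ℝ × ℝ | z.2 ≤ z.1}.indicator (fun z => F z.1 * w z.1 z.2 * f z.2) (τ, t) =
      (Iic τ).indicator (fun t => F τ * (w τ t * f t)) t := fun t => by
    simp only [← mul_assoc]; rfl
  have h2 : Ioc 0 x ∩ Iic τ = Ioc 0 τ := by
    ext t
    simp only [mem_inter_iff, mem_Ioc, mem_Iic]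
    exact ⟨fun h => ⟨h.1.1, h.2⟩, fun h => ⟨⟨h.1, h.2.trans hτ.2⟩, h.2⟩⟩
  simp only [h1]
  rw [setIntegral_indicator measurableSet_Iic, h2, integral_const_mul,
    intervalIntegral.integral_of_le hτ.1.le]

theorem integrableOn_triangle {F f : ℝ → ℂ} {w : ℝ → ℝ → ℂ} {x : ℝ}
    (hF : IntegrableOn F (Ioc 0 x)) (hf : IntegrableOn f (Ioc 0 x))
    (hw : Continuous (Function.uncurry w)) :
    IntegrableOn (fun t => (∫ τ in t..x, F τ * w τ t) * f t) (Ioc 0 x) := by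
  refine (integrable_triangle hF hf hw).integral_prod_right.congr ?_
  filter_upwards [ae_restrict_mem measurableSet_Ioc] with t ht
  exact setIntegral_triangle_fst ht

/-- Interchange of the order of integration over a triangle. -/
theorem integral_triangle_swap {F f : ℝ → ℂ} {w : ℝ → ℝ → ℂ} {x : ℝ} (hx : 0 ≤ x)
    (hF : IntegrableOn F (Ioc 0 x)) (hf : IntegrableOn f (Ioc 0 x))
    (hw : Continuous (Function.uncurry w)) :
    ∫ τ in 0..x, F τ * ∫ t in 0..τ, w τ t * f t =
      ∫ t in 0..x, (∫ τ in t..x, F τ * w τ t) * f t := by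
  rw [intervalIntegral.integral_of_le hx, intervalIntegral.integral_of_le hx]
  have h1 := integral_integral_swap (f := fun τ t => {z : ℝ × ℝ | z.2 ≤ z.1}.indicator
      (fun z => F z.1 * w z.1 z.2 * f z.2) (τ, t)) (integrable_triangle hF hf hw)
  rw [← setIntegral_congr_fun measurableSet_Ioc fun τ hτ => setIntegral_triangle_snd hτ, h1,
    ← setIntegral_congr_fun measurableSet_Ioc fun t ht => setIntegral_triangle_fst ht]

/-- The normalized power `(x - t)^m / m!`. -/
def pw (m : ℕ) (x t : ℝ) : ℂ := ((x - t : ℝ) : ℂ) ^ m / (m.factorial : ℂ)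

theorem continuous_pw (m : ℕ) : Continuous (Function.uncurry (pw m)) := by
  simp only [Function.uncurry_def, pw]
  fun_prop

theorem integral_pw (m : ℕ) (t x : ℝ) : ∫ τ in t..x, pw m τ t = pw (m + 1) x t := by
  have h1 : ∀ τ ∈ uIcc t x, HasDerivAt (fun τ => pw (m + 1) τ t) (pw m τ t) τ := by
    intro τ _
    have h2 := ((((hasDerivAt_id τ).sub_const t).ofReal_comp).pow (m + 1)).div_const
      ((m + 1).factorial : ℂ)
    refine h2.congr_deriv ?_
    have h3 : (m.factorial : ℂ) ≠ 0 := Nat.cast_ne_zero.2 m.factorial_ne_zero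
    have h4 : (m : ℂ) + 1 ≠ 0 := Nat.cast_add_one_ne_zero m
    simp only [pw, Nat.factorial_succ, id]
    push_cast
    field_simp
  rw [intervalIntegral.integral_eq_sub_of_hasDerivAt h1
    (((continuous_pw m).comp (by fun_prop : Continuous fun τ => (τ, t))).intervalIntegrable _ _)]
  simp [pw]

theorem integrableOn_Ioc_of_integrable {f : ℝ → ℂ} (hf : Integrable f mu) {x : ℝ}
    (hx : x ∈ Icc (0 : ℝ) 1) : IntegrableOn f (Ioc 0 x) :=
  IntegrableOn.mono_set hf (fun _ ht => ⟨ht.1.le, ht.2.trans hx.2⟩)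

/-- Cauchy's formula for repeated integration. -/
theorem iterate_J_eq_integral {f : ℝ → ℂ} (hf : Integrable f mu) (m : ℕ) {x : ℝ}
    (hx : x ∈ Icc (0 : ℝ) 1) : (J^[m + 1] f) x = ∫ t in (0 : ℝ)..x, pw m x t * f t := by
  induction m generalizing x with
  | zero => simp [J, pw]
  | succ m ih =>
    rw [Function.iterate_succ_apply']
    have h1 : J (J^[m + 1] f) x = ∫ τ in (0 : ℝ)..x, 1 * ∫ t in (0 : ℝ)..τ, pw m τ t * f t := by
      refine intervalIntegral.integral_congr fun τ hτ => ?_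
      rw [uIcc_of_le hx.1] at hτ
      rw [one_mul]
      exact ih ⟨hτ.1, hτ.2.trans hx.2⟩
    -- With `F = 1` the inner integral after the swap is that of a normalized power, which raises
    -- its degree by one.
    rw [h1, integral_triangle_swap (F := fun _ => 1) hx.1 (by simp)
      (integrableOn_Ioc_of_integrable hf hx) (continuous_pw m)]
    simp only [one_mul, integral_pw]

theorem continuous_pw_left (m : ℕ) (t : ℝ) : Continuous fun x => pw m x t :=
  (continuous_pw m).comp (by fun_prop : Continuous fun x => (x, t))

theorem continuous_pw_right (m : ℕ) (x : ℝ) : Continuous fun t => pw m x t :=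
  (continuous_pw m).comp (by fun_prop : Continuous fun t => (x, t))

theorem integrable_pw_mul {F : ℝ → ℂ} (hF : Integrable F mu) (m : ℕ) (x : ℝ) :
    Integrable (fun τ => pw m x τ * F τ) mu := by
  simpa only [mul_comm] using
    IsPrimitive.integrable_mul_continuousOn hF (continuous_pw_right m x).continuousOn

/-- Cauchy's formula is applied to the outer and to the inner iterate; the swap then collects the
kernel multiplying `f t`. -/
theorem iterate_J_mul_iterate_J {F f : ℝ → ℂ} (hF : Integrable F mu) (hf : MemLp f ∞ mu) (ν j : ℕ)
    {x : ℝ} (hx : x ∈ Icc (0 : ℝ) 1) :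
    (J^[ν + 1] fun τ => F τ * (J^[j + 1] f) τ) x =
      ∫ t in (0 : ℝ)..x, (∫ τ in t..x, pw ν x τ * F τ * pw j τ t) * f t := by
  have hf1 : Integrable f mu := hf.integrable le_top
  rw [iterate_J_eq_integral (integrable_mul_of_top hF (memLp_iterate_J hf _)) ν hx,
    ← integral_triangle_swap hx.1 (integrableOn_Ioc_of_integrable (integrable_pw_mul hF ν x) hx)
      (integrableOn_Ioc_of_integrable hf1 hx) (continuous_pw j)]
  refine intervalIntegral.integral_congr fun τ hτ => ?_
  rw [uIcc_of_le hx.1] at hτ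
  rw [iterate_J_eq_integral hf1 j ⟨hτ.1, hτ.2.trans hx.2⟩, mul_assoc]

/-! ### The kernel: explicit form, majorant, continuity -/

/-- The contribution of one coefficient to the kernel. -/
def kernelTerm (P Q : ℕ → ℝ → ℂ) (k ν : ℕ) (x t : ℝ) : ℂ :=
  if ν = k then pw k x t * coef P Q k k t
  else ∫ τ in t..x, pw ν x τ * coef P Q k ν τ * pw (k - 1 - ν) τ t

/-- The diagonal `ν = k`, where `J^0 f = f` leaves no inner integral, gives the first sum of
`kernel`; `ν = 0 < k` gives the second and `1 ≤ ν ≤ k-1` the third. The third is empty for `k = 1`,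
so its range may start at `1`. -/
theorem kernel_eq_sum (n : ℕ) (P Q : ℕ → ℝ → ℂ) (x t : ℝ) :
    kernel n P Q x t = ∑ k ∈ Finset.range (n + 1), ∑ ν ∈ Finset.range (k + 1),
      (-1) ^ ν * kernelTerm P Q k ν x t := by
  have h0 : ∀ k, ∑ ν ∈ Finset.range (k + 1), (-1) ^ ν * kernelTerm P Q k ν x t =
      (∑ ν ∈ Finset.range k, (-1) ^ ν * kernelTerm P Q k ν x t) +
      (-1) ^ k * pw k x t * (P k t - Complex.I * Q k t) := by
    intro k
    rw [Finset.sum_range_succ, kernelTerm, if_pos rfl, coef]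
    have : skew k k = -1 := by cases k <;> simp [skew]
    rw [this, Nat.choose_self]
    push_cast
    ring
  have h1 : ∀ k, ∑ ν ∈ Finset.range (k + 1), (-1) ^ ν * kernelTerm P Q (k + 1) ν x t =
      (∫ τ in t..x, (P (k + 1) τ + Complex.I * Q (k + 1) τ) * pw k τ t) +
      ∑ ν ∈ Finset.Icc 1 k, (-1) ^ ν * ∫ τ in t..x, pw ν x τ *
        (((k + 1).choose ν : ℂ) * P (k + 1) τ +
          Complex.I * ((k.choose ν : ℂ) - (k.choose (ν - 1) : ℂ)) * Q (k + 1) τ) *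
          pw (k - ν) τ t := by
    intro k
    rw [Finset.sum_range_succ', add_comm]
    congr 1
    · simp [kernelTerm, coef, skew, pw]
    · change _ = ∑ ν ∈ Finset.Ico (0 + 1) (k + 1), _
      rw [← Finset.sum_Ico_add' _ 0 k 1, Nat.Ico_zero_eq_range]
      refine Finset.sum_congr rfl fun ν hν => ?_
      have := Finset.mem_range.1 hν
      rw [kernelTerm, if_neg (by omega)]
      simp only [coef, skew, Nat.add_sub_cancel]
  rw [Finset.sum_congr rfl fun k _ => h0 k, Finset.sum_add_distrib, Finset.sum_range_succ',
    Finset.sum_range_zero, add_zero, Finset.sum_congr rfl fun k _ => h1 k, Finset.sum_add_distrib,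
    add_comm, ← add_assoc]
  refine congrArg₂ _ (congrArg₂ _ rfl ?_) ?_
  · change ∑ k ∈ Finset.Ico (0 + 1) (n + 1), _ = _
    rw [← Finset.sum_Ico_add' _ 0 n 1, Nat.Ico_zero_eq_range]
    rfl
  · have h2 : Finset.Icc 2 n ⊆ Finset.Icc 1 n := Finset.Icc_subset_Icc_left one_le_two
    rw [Finset.sum_subset h2]
    · change ∑ k ∈ Finset.Ico (0 + 1) (n + 1), _ = _
      rw [← Finset.sum_Ico_add' _ 0 n 1, Nat.Ico_zero_eq_range]
      rfl
    · intro k hk hk'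
      simp only [Finset.mem_Icc] at hk hk'
      obtain rfl : k = 1 := by omega
      simp

theorem norm_pw_le_one (m : ℕ) {x t : ℝ} (h0 : 0 ≤ x - t) (h1 : x - t ≤ 1) : ‖pw m x t‖ ≤ 1 := by
  have h2 : (1 : ℝ) ≤ m.factorial := by exact_mod_cast m.factorial_pos
  rw [pw, norm_div, norm_pow, Complex.norm_real, Complex.norm_natCast, Real.norm_of_nonneg h0]
  exact div_le_one_of_le₀ ((pow_le_one₀ h0 h1).trans h2) (by positivity)

/-- A majorant of the kernel. -/
def kernelBound (n : ℕ) (P Q : ℕ → ℝ → ℂ) (t : ℝ) : ℝ :=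
  ∑ k ∈ Finset.range (n + 1), ∑ ν ∈ Finset.range (k + 1),
    (‖coef P Q k ν t‖ + ∫ τ, ‖coef P Q k ν τ‖ ∂mu)

section Kernel

variable {n : ℕ} {P Q : ℕ → ℝ → ℂ}

theorem integrable_kernelBound (hc : ∀ k ≤ n, ∀ ν, Integrable (coef P Q k ν) mu) :
    Integrable (kernelBound n P Q) mu :=
  integrable_finsetSum _ fun k hk => integrable_finsetSum _ fun ν _ =>
    (hc k (Nat.lt_succ_iff.1 (Finset.mem_range.1 hk)) ν).norm.add (integrable_const _)

theorem kernelBound_nonneg (t : ℝ) : 0 ≤ kernelBound n P Q t :=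
  Finset.sum_nonneg fun _ _ => Finset.sum_nonneg fun _ _ =>
    add_nonneg (norm_nonneg _) (integral_nonneg fun _ => norm_nonneg _)

/-- All normalized powers are at most `1` because their arguments lie in `[0,1]`. The diagonal term
is then bounded by the coefficient at `t`, the others by its `L(0,1)` norm. -/
theorem norm_kernelTerm_le {k ν : ℕ} (hc : Integrable (coef P Q k ν) mu) {x t : ℝ}
    (hx : x ∈ Icc (0 : ℝ) 1) (ht : t ∈ Icc 0 x) :
    ‖kernelTerm P Q k ν x t‖ ≤ ‖coef P Q k ν t‖ + ∫ τ, ‖coef P Q k ν τ‖ ∂mu := by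
  have h0 : 0 ≤ ∫ τ, ‖coef P Q k ν τ‖ ∂mu := integral_nonneg fun _ => norm_nonneg _
  have hxt : x - t ≤ 1 := by linarith [ht.1, hx.2]
  rw [kernelTerm]
  split_ifs with h
  · subst h
    rw [norm_mul]
    have := mul_le_mul_of_nonneg_right (norm_pw_le_one ν (sub_nonneg.2 ht.2) hxt)
      (norm_nonneg (coef P Q ν ν t))
    linarith
  · have h1 : ‖∫ τ in t..x, pw ν x τ * coef P Q k ν τ * pw (k - 1 - ν) τ t‖ ≤
        ∫ τ in t..x, ‖coef P Q k ν τ‖ := by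
      refine intervalIntegral.norm_integral_le_of_norm_le ht.2 (Eventually.of_forall fun τ hτ => ?_)
        (intervalIntegrable_of_integrable hc.norm ⟨ht.1, ht.2.trans hx.2⟩ hx)
      rw [norm_mul, norm_mul]
      have h2 := norm_pw_le_one ν (sub_nonneg.2 hτ.2) (by linarith [hτ.1])
      have h3 := norm_pw_le_one (k - 1 - ν) (sub_nonneg.2 hτ.1.le) (by linarith [hτ.2])
      exact (mul_le_of_le_one_right (by positivity) h3).trans
        (mul_le_of_le_one_left (norm_nonneg _) h2)
    have h4 : ∫ τ in t..x, ‖coef P Q k ν τ‖ ≤ ∫ τ, ‖coef P Q k ν τ‖ ∂mu := by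
      rw [intervalIntegral.integral_of_le ht.2]
      exact setIntegral_mono_set hc.norm (Eventually.of_forall fun _ => norm_nonneg _)
        (LE.le.eventuallyLE fun τ hτ => ⟨ht.1.trans hτ.1.le, hτ.2.trans hx.2⟩)
    linarith [norm_nonneg (coef P Q k ν t)]

theorem norm_kernel_le (hc : ∀ k ≤ n, ∀ ν, Integrable (coef P Q k ν) mu) {x t : ℝ}
    (hx : x ∈ Icc (0 : ℝ) 1) (ht : t ∈ Icc 0 x) :
    ‖kernel n P Q x t‖ ≤ kernelBound n P Q t := by
  rw [kernel_eq_sum]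
  refine norm_sum_le_of_le _ fun k hk => norm_sum_le_of_le _ fun ν _ => ?_
  rw [norm_mul, norm_pow, norm_neg, norm_one, one_pow, one_mul]
  exact norm_kernelTerm_le (hc k (Nat.lt_succ_iff.1 (Finset.mem_range.1 hk)) ν) hx ht

theorem integrableOn_kernelTerm_mul {k ν : ℕ} (hc : Integrable (coef P Q k ν) mu) {f : ℝ → ℂ}
    (hf : MemLp f ∞ mu) {x : ℝ} (hx : x ∈ Icc (0 : ℝ) 1) :
    IntegrableOn (fun t => kernelTerm P Q k ν x t * f t) (Ioc 0 x) := by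
  by_cases h : ν = k
  · subst h
    simp only [kernelTerm, if_pos]
    exact integrableOn_Ioc_of_integrable (integrable_mul_of_top (integrable_pw_mul hc ν x) hf) hx
  · simp only [kernelTerm, if_neg h]
    exact integrableOn_triangle (integrableOn_Ioc_of_integrable (integrable_pw_mul hc ν x) hx)
      (integrableOn_Ioc_of_integrable (hf.integrable le_top) hx) (continuous_pw _)

theorem integrableOn_kernel_mul (hc : ∀ k ≤ n, ∀ ν, Integrable (coef P Q k ν) mu) {f : ℝ → ℂ}
    (hf : MemLp f ∞ mu) {x : ℝ} (hx : x ∈ Icc (0 : ℝ) 1) :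
    IntegrableOn (fun t => kernel n P Q x t * f t) (Ioc 0 x) := by
  simp only [kernel_eq_sum, Finset.sum_mul, mul_assoc]
  exact integrable_finsetSum _ fun k hk => integrable_finsetSum _ fun ν _ =>
    (integrableOn_kernelTerm_mul (hc k (Nat.lt_succ_iff.1 (Finset.mem_range.1 hk)) ν)
      hf hx).const_mul _

theorem integrableOn_kernel (hc : ∀ k ≤ n, ∀ ν, Integrable (coef P Q k ν) mu) {x : ℝ}
    (hx : x ∈ Icc (0 : ℝ) 1) : IntegrableOn (kernel n P Q x) (Icc 0 x) := by
  rw [integrableOn_Icc_iff_integrableOn_Ioc]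
  simpa using integrableOn_kernel_mul hc (memLp_const (1 : ℂ)) hx

theorem iterate_J_eq_integral_kernelTerm {k ν : ℕ} (hν : ν ≤ k) (hc : Integrable (coef P Q k ν) mu)
    {f : ℝ → ℂ} (hf : MemLp f ∞ mu) {x : ℝ} (hx : x ∈ Icc (0 : ℝ) 1) :
    (J^[ν + 1] fun τ => coef P Q k ν τ * (J^[k - ν] f) τ) x =
      ∫ t in (0 : ℝ)..x, kernelTerm P Q k ν x t * f t := by
  rcases hν.lt_or_eq with h | rfl
  · simp only [kernelTerm, if_neg h.ne]
    rw [show k - ν = k - 1 - ν + 1 by omega, iterate_J_mul_iterate_J hc hf _ _ hx]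
  · simp only [kernelTerm, if_pos, Nat.sub_self, Function.iterate_zero, id]
    rw [iterate_J_eq_integral (integrable_mul_of_top hc hf) _ hx]
    simp only [mul_assoc]

theorem transfer_eq_integral_kernel (hc : ∀ k ≤ n, ∀ ν, Integrable (coef P Q k ν) mu) {f : ℝ → ℂ}
    (hf : MemLp f ∞ mu) {x : ℝ} (hx : x ∈ Icc (0 : ℝ) 1) :
    transfer n P Q (fun j => J^[j] f) x = ∫ t in (0 : ℝ)..x, kernel n P Q x t * f t := by
  have h1 : ∀ k ∈ Finset.range (n + 1), ∀ ν, IntervalIntegrable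
      (fun t => (-1) ^ ν * (kernelTerm P Q k ν x t * f t)) volume 0 x := fun k hk ν =>
    ((intervalIntegrable_iff_integrableOn_Ioc_of_le hx.1).2 (integrableOn_kernelTerm_mul
      (hc k (Nat.lt_succ_iff.1 (Finset.mem_range.1 hk)) ν) hf hx)).const_mul _
  simp only [kernel_eq_sum, Finset.sum_mul, mul_assoc]
  rw [intervalIntegral.integral_finsetSum fun k hk => by
    simpa only [Finset.sum_fn] using IntervalIntegrable.sum _ fun ν _ => h1 k hk ν]
  refine Finset.sum_congr rfl fun k hk => ?_
  rw [intervalIntegral.integral_finsetSum fun ν _ => h1 k hk ν]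
  refine Finset.sum_congr rfl fun ν hν => ?_
  rw [intervalIntegral.integral_const_mul, iterate_J_eq_integral_kernelTerm
    (Nat.lt_succ_iff.1 (Finset.mem_range.1 hν))
    (hc k (Nat.lt_succ_iff.1 (Finset.mem_range.1 hk)) ν) hf hx]

theorem continuousOn_integral_kernel (hc : ∀ k ≤ n, ∀ ν, Integrable (coef P Q k ν) mu) {f : ℝ → ℂ}
    (hf : MemLp f ∞ mu) :
    ContinuousOn (fun x => ∫ t in (0 : ℝ)..x, kernel n P Q x t * f t) (Icc 0 1) :=
  (isPrimitive_transfer hc fun j _ => memLp_iterate_J hf j).continuousOn.congr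
    fun _ hx => (transfer_eq_integral_kernel hc hf hx).symm

/-- Off the diagonal, Cauchy's formula is read backwards: for fixed `t` the term is `J^(ν+1)` of a
summable function of `τ` cut off to `τ > t`. -/
theorem continuousOn_kernelTerm {k ν : ℕ} (hc : Integrable (coef P Q k ν) mu) {t : ℝ}
    (ht : t ∈ Icc (0 : ℝ) 1) : ContinuousOn (fun x => kernelTerm P Q k ν x t) (Icc t 1) := by
  by_cases h : ν = k
  · simp only [kernelTerm, if_pos h]
    exact ((continuous_pw_left k t).mul continuous_const).continuousOn
  · simp only [kernelTerm, if_neg h]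
    have h1 : Integrable ((Ioi t).indicator fun τ => coef P Q k ν τ * pw (k - 1 - ν) τ t) mu :=
      (IsPrimitive.integrable_mul_continuousOn hc
        (continuous_pw_left _ t).continuousOn).indicator measurableSet_Ioi
    refine ((continuousOn_iterate_J h1 ν).mono (Icc_subset_Icc_left ht.1)).congr fun x hx => ?_
    have hx0 : x ∈ Icc (0 : ℝ) 1 := ⟨ht.1.trans hx.1, hx.2⟩
    have h2 : Ioc 0 x ∩ Ioi t = Ioc t x := by
      ext τ
      simp only [mem_inter_iff, mem_Ioc, mem_Ioi]
      exact ⟨fun h => ⟨h.2, h.1.2⟩, fun h => ⟨⟨ht.1.trans_lt h.1, h.2⟩, h.1⟩⟩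
    have h3 : ∀ τ, pw ν x τ * (Ioi t).indicator
        (fun τ => coef P Q k ν τ * pw (k - 1 - ν) τ t) τ = (Ioi t).indicator
        (fun τ => pw ν x τ * coef P Q k ν τ * pw (k - 1 - ν) τ t) τ := fun τ => by
      simp only [indicator, mul_ite, mul_zero, mul_assoc]
    simp only [iterate_J_eq_integral h1 ν hx0, h3]
    rw [intervalIntegral.integral_of_le hx.1, intervalIntegral.integral_of_le hx0.1,
      setIntegral_indicator measurableSet_Ioi, h2]

theorem continuousOn_kernel (hc : ∀ k ≤ n, ∀ ν, Integrable (coef P Q k ν) mu) {t : ℝ}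
    (ht : t ∈ Icc (0 : ℝ) 1) : ContinuousOn (fun x => kernel n P Q x t) (Icc t 1) := by
  simp only [kernel_eq_sum]
  exact continuousOn_finsetSum _ fun k hk => continuousOn_finsetSum _ fun ν _ =>
    continuousOn_const.mul
      (continuousOn_kernelTerm (hc k (Nat.lt_succ_iff.1 (Finset.mem_range.1 hk)) ν) ht)

end Kernel

/-! ### Bijectivity of Volterra operators on `L_∞(0,1)` -/

theorem IsPrimitive.pow {g h : ℝ → ℂ} (H : IsPrimitive g h) (m : ℕ) :
    IsPrimitive (fun x => g x ^ (m + 1)) (fun x => ((m : ℂ) + 1) * (h x * g x ^ m)) := by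
  induction m with
  | zero => simpa using H
  | succ m ih =>
    refine (ih.mul H).congr (fun x _ => (pow_succ _ _).symm) (Eventually.of_forall fun x => ?_)
    push_cast
    ring

theorem integral_mul_pow_primitive {b : ℝ → ℝ} (hb : Integrable b mu) (m : ℕ) {x : ℝ}
    (hx : x ∈ Icc (0 : ℝ) 1) :
    ∫ t in (0 : ℝ)..x, b t * (∫ s in (0 : ℝ)..t, b s) ^ m =
      (∫ s in (0 : ℝ)..x, b s) ^ (m + 1) / ((m : ℝ) + 1) := by
  have hb' : Integrable (fun t => (b t : ℂ)) mu := hb.ofReal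
  have h1 := ((IsPrimitive.of_J hb').pow m).2 x hx
  have h2 : ∀ t, J (fun t => (b t : ℂ)) t = ((∫ s in (0 : ℝ)..t, b s : ℝ) : ℂ) := fun t =>
    intervalIntegral.integral_ofReal
  simp only [h2, intervalIntegral.integral_same, Complex.ofReal_zero,
    zero_pow (Nat.succ_ne_zero m), zero_add] at h1
  have h3 : (m : ℝ) + 1 ≠ 0 := Nat.cast_add_one_ne_zero m
  rw [eq_div_iff h3, mul_comm, ← intervalIntegral.integral_const_mul]
  have h4 : ∫ t in (0 : ℝ)..x, ((m : ℂ) + 1) * ((b t : ℂ) * ((∫ s in (0 : ℝ)..t, b s : ℝ) : ℂ) ^ m)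
      = ((∫ t in (0 : ℝ)..x, ((m : ℝ) + 1) * (b t * (∫ s in (0 : ℝ)..t, b s) ^ m) : ℝ) : ℂ) := by
    rw [← intervalIntegral.integral_ofReal]
    push_cast
    rfl
  rw [h4] at h1
  exact_mod_cast h1.symm

theorem continuousOn_primitive_real {b : ℝ → ℝ} (hb : Integrable b mu) :
    ContinuousOn (fun x => ∫ s in (0 : ℝ)..x, b s) (Icc 0 1) := by
  have := intervalIntegral.continuousOn_primitive_interval (a := 0) (b := 1) (μ := volume) (f := b)
    (by rwa [uIcc_of_le zero_le_one])
  rwa [uIcc_of_le zero_le_one] at this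

theorem ae_norm_le_norm (f : Linf) : ∀ᵐ x ∂mu, ‖f x‖ ≤ ‖f‖ := by
  have h1 : ∀ᵐ x ∂mu, ‖f x‖ₑ ≤ eLpNorm f ∞ mu := by
    rw [eLpNorm_exponent_top]
    exact ae_le_eLpNormEssSup
  filter_upwards [h1] with x hx
  rw [Lp.norm_def, ← toReal_enorm]
  exact ENNReal.toReal_mono (Lp.eLpNorm_ne_top f) hx

/-- Induction on `m`: with `β(x) = ∫_0^x b`, inserting the bound `‖f‖ β^m/m!` under the integral
yields `‖f‖ β^(m+1)/(m+1)!`, since `b β^m` is the derivative of `β^(m+1)/(m+1)`. -/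
theorem norm_pow_volterra_le {T : Linf →L[ℂ] Linf} {b : ℝ → ℝ} (hb : Integrable b mu)
    (hb0 : ∀ t, 0 ≤ b t) (hT : ∀ f, ∀ᵐ x ∂mu, ‖T f x‖ ≤ ∫ t in (0 : ℝ)..x, b t * ‖f t‖) (m : ℕ)
    (f : Linf) : ∀ᵐ x ∂mu, ‖(T ^ m) f x‖ ≤
      ‖f‖ * ((∫ s in (0 : ℝ)..x, b s) ^ m / m.factorial) := by
  induction m with
  | zero => simpa using ae_norm_le_norm f
  | succ m ih =>
    rw [pow_succ']
    filter_upwards [hT ((T ^ m) f), ae_mu_mem_Icc] with x h1 hx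
    refine h1.trans ?_
    have hg : Integrable (fun t => b t * (‖f‖ *
        ((∫ s in (0 : ℝ)..t, b s) ^ m / m.factorial))) mu :=
      IntegrableOn.mul_continuousOn hb
        (((continuousOn_primitive_real hb).pow m).div_const _ |>.const_mul _) isCompact_Icc
    have hf : Integrable (fun t => b t * ‖(T ^ m) f t‖) mu := by
      refine hg.mono' (hb.1.mul (Lp.aestronglyMeasurable _).norm) ?_
      filter_upwards [ih] with t ht
      rw [Real.norm_of_nonneg (mul_nonneg (hb0 t) (norm_nonneg _))]
      exact mul_le_mul_of_nonneg_left ht (hb0 t)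
    calc ∫ t in (0 : ℝ)..x, b t * ‖(T ^ m) f t‖
        ≤ ∫ t in (0 : ℝ)..x, b t * (‖f‖ * ((∫ s in (0 : ℝ)..t, b s) ^ m / m.factorial)) := by
          rw [intervalIntegral.integral_of_le hx.1, intervalIntegral.integral_of_le hx.1]
          have hs : Ioc 0 x ⊆ Icc 0 1 := fun t ht => ⟨ht.1.le, ht.2.trans hx.2⟩
          refine integral_mono_ae (IntegrableOn.mono_set hf hs) (IntegrableOn.mono_set hg hs) ?_
          filter_upwards [ae_restrict_of_ae_restrict_of_subset hs ih] with t ht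
          exact mul_le_mul_of_nonneg_left ht (hb0 t)
      _ = ‖f‖ / m.factorial * ∫ t in (0 : ℝ)..x, b t * (∫ s in (0 : ℝ)..t, b s) ^ m := by
          rw [← intervalIntegral.integral_const_mul]
          refine intervalIntegral.integral_congr fun t _ => ?_
          ring
      _ = _ := by
          rw [integral_mul_pow_primitive hb m hx, Nat.factorial_succ]
          push_cast
          have h3 : (m : ℝ) + 1 ≠ 0 := Nat.cast_add_one_ne_zero m
          have h4 : (m.factorial : ℝ) ≠ 0 := Nat.cast_ne_zero.2 m.factorial_ne_zero
          field_simp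

theorem norm_le_of_ae_norm_le {f : Linf} {C : ℝ} (hC : 0 ≤ C) (h : ∀ᵐ x ∂mu, ‖f x‖ ≤ C) :
    ‖f‖ ≤ C := by
  simpa using Lp.norm_le_of_ae_bound hC h

/-- An operator of Volterra type is quasinilpotent, so it may be subtracted from the identity. -/
theorem isUnit_one_sub_volterra {T : Linf →L[ℂ] Linf} {b : ℝ → ℝ} (hb : Integrable b mu)
    (hb0 : ∀ t, 0 ≤ b t) (hT : ∀ f, ∀ᵐ x ∂mu, ‖T f x‖ ≤ ∫ t in (0 : ℝ)..x, b t * ‖f t‖) :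
    IsUnit (1 - T) := by
  set β := ∫ s in (0 : ℝ)..1, b s
  have h0 : ∀ x ∈ Icc (0 : ℝ) 1, 0 ≤ ∫ s in (0 : ℝ)..x, b s := fun x hx =>
    intervalIntegral.integral_nonneg hx.1 fun t _ => hb0 t
  have h1 : ∀ x ∈ Icc (0 : ℝ) 1, ∫ s in (0 : ℝ)..x, b s ≤ β := fun x hx =>
    intervalIntegral.integral_mono_interval le_rfl hx.1 hx.2 (Eventually.of_forall hb0)
      (intervalIntegrable_of_integrable hb zero_mem_Icc01 one_mem_Icc01)
  have hβ : 0 ≤ β := h0 1 one_mem_Icc01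
  have h2 : ∀ m, ‖T ^ m‖ ≤ β ^ m / m.factorial := fun m => by
    refine ContinuousLinearMap.opNorm_le_bound _ (by positivity) fun f => ?_
    refine norm_le_of_ae_norm_le (by positivity) ?_
    filter_upwards [norm_pow_volterra_le hb hb0 hT m f, ae_mu_mem_Icc] with x hx hx1
    refine hx.trans ?_
    rw [mul_comm]
    have := h0 x hx1
    have := h1 x hx1
    gcongr
  obtain ⟨m, hm⟩ := ((FloorSemiring.tendsto_pow_div_factorial_atTop β).eventually
    (gt_mem_nhds zero_lt_one)).exists
  have h3 : IsUnit (1 - T ^ m) := isUnit_one_sub_of_norm_lt_one ((h2 m).trans_lt hm)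
  -- `1 - T^m` is `1 - T` times a geometric sum that commutes with it, so a unit product makes each
  -- factor a unit.
  rw [← mul_neg_geom_sum] at h3
  refine ((Commute.isUnit_mul_iff ?_).1 h3).1
  exact (Commute.sum_right _ _ _ fun i _ => (Commute.one_left _).sub_left (Commute.self_pow T i))

theorem exists_continuousLinearMap (Φ : Linf → ℝ → ℂ) (hΦ : ∀ f, MemLp (Φ f) ∞ mu)
    (hadd : ∀ f g, ∀ᵐ x ∂mu, Φ (f + g) x = Φ f x + Φ g x)
    (hsmul : ∀ (c : ℂ) f, ∀ᵐ x ∂mu, Φ (c • f) x = c * Φ f x) {C : ℝ} (hC0 : 0 ≤ C)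
    (hC : ∀ f, ∀ᵐ x ∂mu, ‖Φ f x‖ ≤ C * ‖f‖) :
    ∃ T : Linf →L[ℂ] Linf, ∀ f, T f =ᵐ[mu] Φ f := by
  let L : Linf →ₗ[ℂ] Linf :=
    { toFun := fun f => (hΦ f).toLp (Φ f)
      map_add' := fun f g => by
        rw [← MemLp.toLp_add]
        exact (MemLp.toLp_eq_toLp_iff _ _).2 (hadd f g)
      map_smul' := fun c f => by
        rw [RingHom.id_apply, ← MemLp.toLp_const_smul]
        exact (MemLp.toLp_eq_toLp_iff _ _).2 (hsmul c f) }
  refine ⟨L.mkContinuous C fun f => norm_le_of_ae_norm_le (by positivity) ?_,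
    fun f => (hΦ f).coeFn_toLp⟩
  filter_upwards [(hΦ f).coeFn_toLp, hC f] with x h1 h2
  change ‖(hΦ f).toLp (Φ f) x‖ ≤ _
  rwa [h1]

/-- The operator `f ↦ m f + ∫_0^x K(x,t) f(t) dt` with a dominated kernel is a bounded bijection
of `L_∞(0,1)` when the multiplier `m` is continuous and does not vanish. -/
theorem exists_bijective_volterra {m : ℝ → ℂ} {K : ℝ → ℝ → ℂ} {a : ℝ → ℝ}
    (hm : ContinuousOn m (Icc 0 1)) (hm0 : ∀ x ∈ Icc (0 : ℝ) 1, m x ≠ 0) (ha : Integrable a mu)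
    (ha0 : ∀ t, 0 ≤ a t) (hKa : ∀ x ∈ Icc (0 : ℝ) 1, ∀ t ∈ Icc 0 x, ‖K x t‖ ≤ a t)
    (hK : ∀ f : ℝ → ℂ, MemLp f ∞ mu → ∀ x ∈ Icc (0 : ℝ) 1,
      IntegrableOn (fun t => K x t * f t) (Ioc 0 x))
    (hKc : ∀ f : ℝ → ℂ, MemLp f ∞ mu →
      ContinuousOn (fun x => ∫ t in (0 : ℝ)..x, K x t * f t) (Icc 0 1)) :
    ∃ B : Linf →L[ℂ] Linf, Function.Bijective B ∧ ∀ f : Linf, ∀ᵐ x ∂mu,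
      B f x = m x * f x + ∫ t in (0 : ℝ)..x, K x t * f t := by
  set V : Linf → ℝ → ℂ := fun f x => ∫ t in (0 : ℝ)..x, K x t * f t with hV
  have hV1 : ∀ f, MemLp (V f) ∞ mu := fun f => memLp_of_continuousOn (hKc f (Lp.memLp f))
  have hVadd : ∀ f g, ∀ x ∈ Icc (0 : ℝ) 1, V (f + g) x = V f x + V g x := by
    intro f g x hx
    have hi := fun f : Linf => (intervalIntegrable_iff_integrableOn_Ioc_of_le hx.1).2
      (hK f (Lp.memLp f) x hx)
    rw [hV, ← intervalIntegral.integral_add (hi f) (hi g)]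
    refine intervalIntegral.integral_congr_ae ?_
    filter_upwards [ae_mu_iff.1 (Lp.coeFn_add f g)] with t ht h1
    rw [uIoc_of_le hx.1] at h1
    rw [ht ⟨h1.1.le, h1.2.trans hx.2⟩, Pi.add_apply, mul_add]
  have hVsmul : ∀ (c : ℂ) f, ∀ x ∈ Icc (0 : ℝ) 1, V (c • f) x = c * V f x := by
    intro c f x hx
    rw [hV, ← intervalIntegral.integral_const_mul]
    refine intervalIntegral.integral_congr_ae ?_
    filter_upwards [ae_mu_iff.1 (Lp.coeFn_smul c f)] with t ht h1
    rw [uIoc_of_le hx.1] at h1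
    rw [ht ⟨h1.1.le, h1.2.trans hx.2⟩, Pi.smul_apply, smul_eq_mul, mul_left_comm]
  have hVle : ∀ f, ∀ x ∈ Icc (0 : ℝ) 1, ‖V f x‖ ≤ ∫ t in (0 : ℝ)..x, a t * ‖f t‖ := by
    intro f x hx
    refine intervalIntegral.norm_integral_le_of_norm_le hx.1 (Eventually.of_forall fun t ht => ?_)
      (intervalIntegrable_of_integrable (memLp_one_iff_integrable.1
        ((Lp.memLp f).norm.mul (memLp_one_iff_integrable.2 ha))) zero_mem_Icc01 hx)
    rw [norm_mul]
    exact mul_le_mul_of_nonneg_right (hKa x hx t (Ioc_subset_Icc_self ht)) (norm_nonneg _)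
  have hVle' : ∀ f, ∀ x ∈ Icc (0 : ℝ) 1, ‖V f x‖ ≤ (∫ t, a t ∂mu) * ‖f‖ := by
    intro f x hx
    refine (hVle f x hx).trans ?_
    have hs : Ioc 0 x ⊆ Icc 0 1 := fun t ht => ⟨ht.1.le, ht.2.trans hx.2⟩
    rw [intervalIntegral.integral_of_le hx.1, ← integral_mul_const]
    have hi : Integrable (fun t => a t * ‖f t‖) mu := memLp_one_iff_integrable.1
        ((Lp.memLp f).norm.mul (memLp_one_iff_integrable.2 ha))
    refine (setIntegral_mono_set hi (Eventually.of_forall fun t => mul_nonneg (ha0 t)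
      (norm_nonneg _)) (LE.le.eventuallyLE hs)).trans (integral_mono_ae hi (ha.mul_const _) ?_)
    filter_upwards [ae_norm_le_norm f] with t ht
    exact mul_le_mul_of_nonneg_left ht (ha0 t)
  have ha1 : 0 ≤ ∫ t, a t ∂mu := integral_nonneg ha0
  have hmi : ContinuousOn (fun x => (m x)⁻¹) (Icc 0 1) := hm.inv₀ hm0
  obtain ⟨M, hM⟩ := isCompact_Icc.exists_bound_of_continuousOn hm
  obtain ⟨c, hc⟩ := isCompact_Icc.exists_bound_of_continuousOn hmi
  have hM0 : 0 ≤ M := (norm_nonneg _).trans (hM 0 zero_mem_Icc01)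
  have hc0 : 0 ≤ c := (norm_nonneg _).trans (hc 0 zero_mem_Icc01)
  -- `T` is chosen so that `B = m (1 - T)`; the multiplier is invertible, and only `1 - T` needs the
  -- Volterra estimate.
  obtain ⟨T, hT⟩ := exists_continuousLinearMap (fun f x => -(m x)⁻¹ * V f x)
    (fun f => memLp_of_continuousOn (hmi.neg.mul (hKc f (Lp.memLp f))))
    (fun f g => by
      filter_upwards [ae_mu_mem_Icc] with x hx
      rw [hVadd f g x hx, mul_add])
    (fun k f => by
      filter_upwards [ae_mu_mem_Icc] with x hx
      rw [hVsmul k f x hx, mul_left_comm])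
    (C := c * ∫ t, a t ∂mu) (by positivity)
    (fun f => by
      filter_upwards [ae_mu_mem_Icc] with x hx
      rw [norm_mul, norm_neg, mul_assoc]
      exact mul_le_mul (hc x hx) (hVle' f x hx) (norm_nonneg _) hc0)
  obtain ⟨B, hB⟩ := exists_continuousLinearMap (fun f x => m x * f x + V f x)
    (fun f => ((Lp.memLp f).mul (r := ∞) (memLp_of_continuousOn (r := ∞) hm)).add (hV1 f))
    (fun f g => by
      filter_upwards [ae_mu_mem_Icc, Lp.coeFn_add f g] with x hx h1
      rw [hVadd f g x hx, h1, Pi.add_apply]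
      ring)
    (fun k f => by
      filter_upwards [ae_mu_mem_Icc, Lp.coeFn_smul k f] with x hx h1
      rw [hVsmul k f x hx, h1, Pi.smul_apply, smul_eq_mul]
      ring)
    (C := M + ∫ t, a t ∂mu) (by positivity)
    (fun f => by
      filter_upwards [ae_mu_mem_Icc, ae_norm_le_norm f] with x hx h1
      refine (norm_add_le _ _).trans ?_
      rw [norm_mul, add_mul]
      exact add_le_add (mul_le_mul (hM x hx) h1 (norm_nonneg _) hM0) (hVle' f x hx))
  have hu : IsUnit (1 - T) := by
    refine isUnit_one_sub_volterra (b := fun t => c * a t) (ha.const_mul c)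
      (fun t => mul_nonneg hc0 (ha0 t)) fun f => ?_
    filter_upwards [hT f, ae_mu_mem_Icc] with x h1 hx
    rw [h1, norm_mul, norm_neg]
    simp only [mul_assoc, intervalIntegral.integral_const_mul]
    exact mul_le_mul (hc x hx) (hVle f x hx) (norm_nonneg _) hc0
  have hBT : ∀ f, ∀ᵐ x ∂mu, B f x = m x * ((1 - T) f) x := fun f => by
    filter_upwards [hB f, hT f, Lp.coeFn_sub f (T f), ae_mu_mem_Icc] with x h1 h2 h3 hx
    have h4 : ((1 - T) f) x = f x - T f x := h3
    rw [h1, h4, h2]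
    field_simp [hm0 x hx]
    ring
  have hbij : Function.Bijective (1 - T : Linf →L[ℂ] Linf) := by
    obtain ⟨S, hS1, hS2⟩ := isUnit_iff_exists.1 hu
    exact Function.bijective_iff_has_inverse.2 ⟨S, fun f => DFunLike.congr_fun hS2 f,
      fun f => DFunLike.congr_fun hS1 f⟩
  refine ⟨B, ⟨?_, fun g => ?_⟩, hB⟩
  · refine (injective_iff_map_eq_zero B).2 fun f hf => ?_
    refine (injective_iff_map_eq_zero _).1 hbij.1 f (Lp.ext ?_)
    have h0 : B f =ᵐ[mu] (0 : ℝ → ℂ) := by rw [hf]; exact Lp.coeFn_zero _ _ _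
    filter_upwards [hBT f, h0, ae_mu_mem_Icc, Lp.coeFn_zero ℂ ∞ mu] with x h1 h2 hx h3
    rw [h2, Pi.zero_apply] at h1
    rw [h3, Pi.zero_apply]
    exact (mul_eq_zero.1 h1.symm).resolve_left (hm0 x hx)
  · have hg : MemLp (fun x => (m x)⁻¹ * g x) ∞ mu :=
      (Lp.memLp g).mul (r := ∞) (memLp_of_continuousOn (r := ∞) hmi)
    obtain ⟨f, hf⟩ := hbij.2 (hg.toLp _)
    refine ⟨f, Lp.ext ?_⟩
    filter_upwards [hBT f, hg.coeFn_toLp, ae_mu_mem_Icc] with x h1 h2 hx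
    rw [h1, hf, h2, mul_inv_cancel_left₀ (hm0 x hx)]

/-! ### Functions annihilating the derivatives of all test functions -/

theorem support_iteratedDeriv_subset_tsupport (F : ℝ → ℂ) (m : ℕ) :
    Function.support (iteratedDeriv m F) ⊆ tsupport F := by
  induction m with
  | zero => simpa using subset_tsupport F
  | succ m ih =>
    rw [iteratedDeriv_succ]
    exact support_deriv_subset.trans (closure_minimal ih (isClosed_tsupport F))

theorem isPrimitive_iteratedDeriv {F : ℝ → ℂ} (hF : ContDiff ℝ (⊤ : ℕ∞) F) (m : ℕ) :
    IsPrimitive (iteratedDeriv m F) (iteratedDeriv (m + 1) F) := by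
  have hc : ∀ m : ℕ, Continuous (iteratedDeriv m F) := fun m =>
    hF.continuous_iteratedDeriv m (by exact_mod_cast le_top)
  refine ⟨integrable_of_continuousOn (hc _).continuousOn, fun x _ => ?_⟩
  rw [intervalIntegral.integral_eq_sub_of_hasDerivAt (f := iteratedDeriv m F) (fun t _ => ?_)
    ((hc _).intervalIntegrable _ _)]
  · ring
  · rw [iteratedDeriv_succ]
    exact (hF.differentiable_iteratedDeriv m (by exact_mod_cast ENat.natCast_lt_top m)
      |>.differentiableAt).hasDerivAt

/-- There is a test function of every order with nonzero mean that vanishes on `[s,1]`. -/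
theorem exists_memTest_integral_ne_zero (k : ℕ) {s : ℝ} (hs : s ∈ Ioo (0 : ℝ) 1) :
    ∃ χ : ℝ → ℂ, MemTest ∞ k χ ∧ ∫ x, χ x ∂mu ≠ 0 ∧ ∀ᵐ x ∂mu, s ≤ x → d^[k] χ x = 0 := by
  obtain ⟨f, hf1, hf2, hf3, hf4, hf5⟩ := exists_contDiff_tsupport_subset (n := ⊤)
    (Ioo_mem_nhds (half_pos hs.1) (half_lt_self hs.1))
  set F : ℝ → ℂ := fun x => (f x : ℂ) with hF
  have hFc : ContDiff ℝ (⊤ : ℕ∞) F := Complex.ofRealCLM.contDiff.comp hf3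
  have hsupp : tsupport F ⊆ Ioo 0 s := by
    refine subset_trans (closure_mono (t := Function.support f) fun x hx hfx => hx ?_) hf1
    simp [hF, hfx]
  have h0 : ∀ m : ℕ, ∀ x, x ∉ Ioo 0 s → iteratedDeriv m F x = 0 := fun m x hx => by
    by_contra h
    exact hx (hsupp (support_iteratedDeriv_subset_tsupport F m h))
  have hch : ∀ j < k, IsPrimitive (iteratedDeriv j F) (iteratedDeriv (j + 1) F) :=
    fun j _ => isPrimitive_iteratedDeriv hFc j
  have he : EqOn F (iteratedDeriv 0 F) (Icc 0 1) := fun x _ => by simp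
  have hj := iterate_d_eqOn_of_chain hch he
  refine ⟨F, ⟨memW_of_chain hch he (memLp_of_continuousOn
    (hFc.continuous_iteratedDeriv k (by exact_mod_cast le_top)).continuousOn), fun j hjk => ?_⟩,
    ?_, ?_⟩
  · rw [hj j hjk zero_mem_Icc01, hj j hjk one_mem_Icc01]
    exact ⟨h0 j 0 (by simp), h0 j 1 (fun h => absurd h.2 hs.2.not_gt)⟩
  · have h1 : ∫ x, F x ∂mu = ((∫ x, f x : ℝ) : ℂ) := by
      rw [setIntegral_eq_integral_of_forall_compl_eq_zero]
      · exact integral_ofReal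
      · intro x hx
        refine (by simpa using h0 0 x fun h => hx ⟨h.1.le, (h.2.trans hs.2).le⟩)
    have h2 : 0 < ∫ x, f x :=
      hf3.continuous.integral_pos_of_hasCompactSupport_nonneg_nonzero hf2
        (fun x => (hf4 (mem_range_self x)).1) (x := s / 2) (by rw [hf5]; exact one_ne_zero)
    rw [h1]
    exact_mod_cast h2.ne'
  · filter_upwards [iterate_d_ae_eq_of_chain hch he] with x hx hsx
    rw [hx]
    exact h0 k x fun h => absurd h.2 hsx.not_gt

/-- A function vanishing near `0` that annihilates the derivatives of order `k` of all test
functions of order `k` vanishes. -/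
theorem ae_eq_zero_of_forall_memTest {s : ℝ} (hs : s ∈ Ioo (0 : ℝ) 1) {h : ℝ → ℂ}
    (hi : Integrable h mu) (h0 : ∀ᵐ x ∂mu, x < s → h x = 0) (k : ℕ)
    (hk : ∀ φ, MemTest ∞ k φ → ∫ x, h x * d^[k] φ x ∂mu = 0) : h =ᵐ[mu] 0 := by
  induction k with
  | zero =>
    refine ae_eq_zero_of_forall_setIntegral_eq_of_sigmaFinite (fun A _ _ => hi.integrableOn)
      fun A hA _ => ?_
    have h1 := hk (A.indicator fun _ => 1)
      ⟨⟨fun j hj => absurd hj (Nat.not_lt_zero j), (memLp_const (1 : ℂ)).indicator hA⟩,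
        fun j hj => absurd hj (Nat.not_lt_zero j)⟩
    rw [← integral_indicator hA, ← h1]
    refine integral_congr_ae (Eventually.of_forall fun x => ?_)
    simp [indicator]
  | succ k ih =>
    refine ih fun φ hφ => ?_
    obtain ⟨χ, hχ, hχ1, hχ2⟩ := exists_memTest_integral_ne_zero k hs
    -- This `c` makes `φ + c χ` have mean zero, so its primitive is a test function of order `k+1`.
    -- The correction does not affect the integral: `h` vanishes left of `s`, and `χ^(k)` vanishes
    -- from `s` on.
    set c : ℂ := -((∫ x, φ x ∂mu) / ∫ x, χ x ∂mu) with hc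
    have hLp : ∀ {g : ℝ → ℂ}, MemW ∞ k g → ∀ j ≤ k, Integrable (d^[j] g) mu := fun hg j hj =>
      (hg.memLp_top hj).integrable le_top
    set G : ℕ → ℝ → ℂ := fun j x => d^[j] φ x + c * d^[j] χ x with hG
    have hGi : ∀ j ≤ k, Integrable (G j) mu := fun j hj =>
      (hLp hφ.1 j hj).add ((hLp hχ.1 j hj).const_mul c)
    set ψ : ℕ → ℝ → ℂ := fun j => Nat.casesOn j (J (G 0)) G with hψ
    have hch : ∀ j < k + 1, IsPrimitive (ψ j) (ψ (j + 1)) := by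
      intro j hj
      cases j with
      | zero => exact IsPrimitive.of_J (hGi 0 (Nat.zero_le k))
      | succ j =>
        exact (hφ.1.isPrimitive le_top (j := j) (by omega)).add
          ((hχ.1.isPrimitive le_top (j := j) (by omega)).const_mul c)
    have he : EqOn (J (G 0)) (ψ 0) (Icc 0 1) := fun _ _ => rfl
    have hd := iterate_d_eqOn_of_chain hch he
    have hψT : MemTest ∞ (k + 1) (J (G 0)) := by
      refine ⟨memW_of_chain hch he ((hφ.1.memLp_top le_rfl).add
        ((hχ.1.memLp_top le_rfl).const_mul c)), fun j hj => ?_⟩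
      rw [hd j hj zero_mem_Icc01, hd j hj one_mem_Icc01]
      cases j with
      | zero =>
        refine ⟨by simp [hψ, J], ?_⟩
        change ∫ x in (0 : ℝ)..1, G 0 x = 0
        rw [← integral_mu_eq, hG, integral_add (hLp hφ.1 0 (Nat.zero_le k))
          ((hLp hχ.1 0 (Nat.zero_le k)).const_mul c), integral_const_mul]
        simp only [Function.iterate_zero, id, hc]
        field_simp
        ring
      | succ j =>
        have h1 := hφ.2 j (by omega)
        have h2 := hχ.2 j (by omega)
        simp [hψ, hG, h1.1, h1.2, h2.1, h2.2]
    rw [← hk _ hψT]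
    refine integral_congr_ae ?_
    filter_upwards [iterate_d_ae_eq_of_chain hch he, h0, hχ2] with x hx hx0 hx1
    rw [hx]
    change h x * d^[k] φ x = h x * (d^[k] φ x + c * d^[k] χ x)
    rcases lt_or_ge x s with hxs | hxs
    · simp [hx0 hxs]
    · simp [hx1 hxs]

/-! ### Independence of the kernel from the primitives -/

section Uniqueness

variable {n : ℕ} {q₀ : ℝ → ℂ} {q p : ℕ → Functional} {P Q P' Q' : ℕ → ℝ → ℂ}

theorem integral_kernel_eq_zero_of_lt {f : ℝ → ℂ} {s x : ℝ} (hf0 : ∀ t ≤ s, f t = 0)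
    (hx : 0 ≤ x) (hxs : x ≤ s) : ∫ t in (0 : ℝ)..x, kernel n P Q x t * f t = 0 := by
  rw [← intervalIntegral.integral_zero (E := ℂ) (μ := volume) (a := 0) (b := x)]
  refine intervalIntegral.integral_congr fun t ht => ?_
  rw [uIcc_of_le hx] at ht
  simp [hf0 t (ht.2.trans hxs)]

/-- For `y = J^n f` the expression is computed with both choices of primitives. The leading terms
agree and cancel, so the difference of the Volterra integrals annihilates all `φ^(n+1)`.
Orthogonality alone would leave a polynomial; vanishing of the difference on `[0,s]` rules it out.
-/
theorem integral_kernel_eq (hq : MemW 1 1 q₀) (hPQ : Primitives n q₀ q p P Q)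
    (hPQ' : Primitives n q₀ q p P' Q') {f : ℝ → ℂ} (hf : MemLp f ∞ mu) {s : ℝ}
    (hs : s ∈ Ioo (0 : ℝ) 1) (hf0 : ∀ t ≤ s, f t = 0) {x : ℝ} (hx : x ∈ Icc (0 : ℝ) 1) :
    ∫ t in (0 : ℝ)..x, kernel n P Q x t * f t = ∫ t in (0 : ℝ)..x, kernel n P' Q' x t * f t := by
  have hc : ∀ k ≤ n, ∀ ν, Integrable (coef P Q k ν) mu := fun k hk ν => hPQ.integrable_coef hq hk ν
  have hc' : ∀ k ≤ n, ∀ ν, Integrable (coef P' Q' k ν) mu :=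
    fun k hk ν => hPQ'.integrable_coef hq hk ν
  have hV := continuousOn_integral_kernel hc hf
  have hV' := continuousOn_integral_kernel hc' hf
  set V := fun x => ∫ t in (0 : ℝ)..x, kernel n P Q x t * f t
  set V' := fun x => ∫ t in (0 : ℝ)..x, kernel n P' Q' x t * f t
  obtain ⟨hy, hyd⟩ := memW_iterate_J hf n
  have hT : EqOn (transfer n P Q (fun j => d^[n - j] (J^[n] f))) V (Icc 0 1) := fun x hx =>
    (transfer_congr_ae hyd hx).trans (transfer_eq_integral_kernel hc hf hx)
  have hT' : EqOn (transfer n P' Q' (fun j => d^[n - j] (J^[n] f))) V' (Icc 0 1) := fun x hx =>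
    (transfer_congr_ae hyd hx).trans (transfer_eq_integral_kernel hc' hf hx)
  have hzero : (fun x => V x - V' x) =ᵐ[mu] 0 := by
    refine ae_eq_zero_of_forall_memTest hs (integrable_of_continuousOn (hV.sub hV')) ?_ (n + 1)
      fun φ hφ => ?_
    · filter_upwards [ae_mu_mem_Icc] with t ht hts
      simp only [V, V', integral_kernel_eq_zero_of_lt hf0 ht.1 hts.le, sub_zero]
    -- Test functions with a bounded top derivative suffice here, and they are among those of
    -- exponent `1`.
    · have hφ1 : MemTest 1 (n + 1) φ := ⟨⟨hφ.1.1, hφ.1.2.mono_exponent le_top⟩, hφ.2⟩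
      have h1 := (ell_apply hq hPQ hy hφ1).symm.trans (ell_apply hq hPQ' hy hφ1)
      have h2 := mul_left_cancel₀ (pow_ne_zero _ (neg_ne_zero.2 one_ne_zero)) h1
      have hdφ := memLp_one_iff_integrable.1 hφ1.1.2
      have hlead : Integrable (fun x => 2 * Complex.I * q₀ x * d^[n] (J^[n] f) x * d^[n + 1] φ x)
          mu := by
        refine ((integrable_mul_of_top (IsPrimitive.integrable_mul_continuousOn hdφ
          (hq.continuousOn (j := 0) zero_lt_one)) hy.2).const_mul (2 * Complex.I)).congr
          (Eventually.of_forall fun x => ?_)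
        simp only [Function.iterate_zero, id]; ring
      have hi : ∀ {W : ℝ → ℂ}, ContinuousOn W (Icc 0 1) →
          Integrable (fun x => W x * d^[n + 1] φ x) mu := fun hW => by
        simpa only [mul_comm] using IsPrimitive.integrable_mul_continuousOn hdφ hW
      have h3 : ∀ {W R : ℝ → ℂ}, ContinuousOn W (Icc 0 1) → EqOn R W (Icc 0 1) →
          ∫ x, (2 * Complex.I * q₀ x * d^[n] (J^[n] f) x + R x) * d^[n + 1] φ x ∂mu =
          ∫ x, 2 * Complex.I * q₀ x * d^[n] (J^[n] f) x * d^[n + 1] φ x ∂mu +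
            ∫ x, W x * d^[n + 1] φ x ∂mu := by
        intro W R hW hR
        rw [← integral_add hlead (hi hW)]
        refine integral_congr_ae ?_
        filter_upwards [ae_mu_mem_Icc] with x hx
        rw [hR hx, add_mul]
      rw [h3 hV hT, h3 hV' hT'] at h2
      simp only [sub_mul]
      rw [integral_sub (hi hV) (hi hV'), add_left_cancel h2, sub_self]
  exact sub_eq_zero.1 (Measure.eqOn_Icc_of_ae_eq (μ := volume) zero_ne_one hzero (hV.sub hV')
    continuousOn_const hx)

/-- Indicators of measurable subsets of `(s,x]` are admissible `f`, so the two kernels have equal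
integrals over all such sets. -/
theorem kernel_ae_eq_of_mem_Ioc (hq : MemW 1 1 q₀) (hPQ : Primitives n q₀ q p P Q)
    (hPQ' : Primitives n q₀ q p P' Q') {s : ℝ} (hs : s ∈ Ioo (0 : ℝ) 1) {x : ℝ}
    (hx : x ∈ Icc (0 : ℝ) 1) :
    ∀ᵐ t : ℝ, t ∈ Ioc s x → kernel n P Q x t = kernel n P' Q' x t := by
  have hc : ∀ k ≤ n, ∀ ν, Integrable (coef P Q k ν) mu := fun k hk ν => hPQ.integrable_coef hq hk ν
  have hc' : ∀ k ≤ n, ∀ ν, Integrable (coef P' Q' k ν) mu :=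
    fun k hk ν => hPQ'.integrable_coef hq hk ν
  have hsub : Ioc s x ⊆ Icc 0 x := fun t ht => ⟨(hs.1.trans ht.1).le, ht.2⟩
  have hi := (integrableOn_kernel hc hx).mono_set hsub
  have hi' := (integrableOn_kernel hc' hx).mono_set hsub
  refine (ae_restrict_iff' measurableSet_Ioc).1 ?_
  refine ae_eq_of_forall_setIntegral_eq_of_sigmaFinite (fun A _ _ => hi.integrable.integrableOn)
    (fun A _ _ => hi'.integrable.integrableOn) fun A hA _ => ?_
  have h1 := integral_kernel_eq hq hPQ hPQ' (f := (A ∩ Ioi s).indicator fun _ => 1)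
    ((memLp_const (1 : ℂ)).indicator (hA.inter measurableSet_Ioi)) hs
    (fun t ht => indicator_of_notMem (fun h => absurd h.2 ht.not_gt) _) hx
  have h2 : ∀ g : ℝ → ℂ, ∫ t in (0 : ℝ)..x, g t * (A ∩ Ioi s).indicator (fun _ => 1) t =
      ∫ t in A, g t ∂(volume.restrict (Ioc s x)) := by
    intro g
    have h3 : ∀ t, g t * (A ∩ Ioi s).indicator (fun _ => 1) t = (A ∩ Ioi s).indicator g t :=
      fun t => by simp [indicator]
    have h4 : Ioc 0 x ∩ (A ∩ Ioi s) = A ∩ Ioc s x := by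
      ext t
      simp only [mem_inter_iff, mem_Ioc, mem_Ioi]
      exact ⟨fun h => ⟨h.2.1, h.2.2, h.1.2⟩, fun h => ⟨⟨hs.1.trans h.2.1, h.2.2⟩, h.1, h.2.1⟩⟩
    simp only [h3]
    rw [intervalIntegral.integral_of_le hx.1,
      setIntegral_indicator (hA.inter measurableSet_Ioi), h4, Measure.restrict_restrict hA]
  rwa [h2, h2] at h1

/-- The kernel does not depend on the choice of the primitives. -/
theorem ae_forall_kernel_eq (hq : MemW 1 1 q₀) (hPQ : Primitives n q₀ q p P Q)
    (hPQ' : Primitives n q₀ q p P' Q') :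
    ∀ᵐ t ∂mu, ∀ x ∈ Icc t 1, kernel n P Q x t = kernel n P' Q' x t := by
  -- The null set must not depend on `x`, so only countably many `x` and `s` are used: rational `x`,
  -- and `s = 1/(m+2)`, which lies strictly inside `(0,1)` and tends to `0`.
  have h1 : ∀ᵐ t : ℝ, ∀ (m : ℕ) (r : ℚ), (r : ℝ) ∈ Icc (0 : ℝ) 1 →
      t ∈ Ioc (1 / ((m : ℝ) + 2)) r → kernel n P Q r t = kernel n P' Q' r t := by
    refine ae_all_iff.2 fun m => ae_all_iff.2 fun r => ?_
    by_cases hr : (r : ℝ) ∈ Icc (0 : ℝ) 1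
    · filter_upwards [kernel_ae_eq_of_mem_Ioc hq hPQ hPQ' (s := 1 / ((m : ℝ) + 2))
        ⟨by positivity, by rw [div_lt_one (by positivity)]; linarith [m.cast_nonneg (α := ℝ)]⟩ hr]
        with t ht _ h using ht h
    · exact Eventually.of_forall fun t h => absurd h hr
  filter_upwards [ae_restrict_of_ae h1, ae_mu_mem_Ioo] with t ht ht01
  have ht' : t ∈ Icc (0 : ℝ) 1 := Ioo_subset_Icc_self ht01
  obtain ⟨m, hm⟩ := exists_nat_one_div_lt ht01.1
  have hm' : 1 / ((m : ℝ) + 2) < t := lt_of_le_of_lt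
    (one_div_le_one_div_of_le (by positivity) (by linarith)) hm
  have h2 : EqOn (fun x => kernel n P Q x t) (fun x => kernel n P' Q' x t)
      (Ioo t 1 ∩ range ((↑) : ℚ → ℝ)) := by
    rintro _ ⟨hx, r, rfl⟩
    exact ht m r ⟨ht01.1.le.trans hx.1.le, hx.2.le⟩ ⟨hm', hx.1.le⟩
  -- Both kernels are continuous in `x` on `[t,1]`, and the rationals of `(t,1)` are dense there.
  refine h2.of_subset_closure (continuousOn_kernel (fun k hk ν => hPQ.integrable_coef hq hk ν) ht')
    (continuousOn_kernel (fun k hk ν => hPQ'.integrable_coef hq hk ν) ht')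
    (inter_subset_left.trans Ioo_subset_Icc_self) ?_
  rw [← closure_Ioo ht01.2.ne]
  exact closure_minimal (Rat.denseRange_cast.open_subset_closure_inter isOpen_Ioo) isClosed_closure

end Uniqueness

/-! ### Choice of primitives and the main theorem -/

theorem Coefficients.exists_primitives {n : ℕ} {q₀ : ℝ → ℂ}
    {q p : ℕ → OddSingular.Functional} (hcoef : OddSingular.Coefficients n q₀ q p) :
    ∃ P Q, OddSingular.Primitives n q₀ q p P Q := by
  have hp : ∀ k, ∃ σ : ℝ → ℂ, k ≤ n → MemLp σ 1 mu ∧ IsGenDeriv 1 k σ (p k) := fun k => by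
    by_cases hk : k ≤ n
    · obtain ⟨σ, hσ⟩ := hcoef.p_mem k hk
      exact ⟨σ, fun _ => hσ⟩
    · exact ⟨0, fun h => absurd h hk⟩
  have hq : ∀ k, ∃ σ : ℝ → ℂ, 1 ≤ k → k ≤ n → MemLp σ 1 mu ∧ IsGenDeriv 1 (k - 1) σ (q k) :=
    fun k => by
      by_cases hk : 1 ≤ k ∧ k ≤ n
      · obtain ⟨σ, hσ⟩ := hcoef.q_mem k hk.1 hk.2
        exact ⟨σ, fun _ _ => hσ⟩
      · exact ⟨0, fun h h' => absurd ⟨h, h'⟩ hk⟩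
  choose P hP using hp
  choose Q hQ using hq
  refine ⟨P, fun k => if k = 0 then d q₀ else Q k, fun k hk => (hP k hk).1, fun k hk => (hP k hk).2,
    by simp, fun k h1 hk => ?_, fun k h1 hk => ?_⟩
  · rw [if_neg (by omega)]
    exact (hQ k h1 hk).1
  · rw [if_neg (by omega)]
    exact (hQ k h1 hk).2

end OddSingular

end

open OddSingular in
theorem mainTheorem4 (n : ℕ) (q₀ : ℝ → ℂ) (q p : ℕ → OddSingular.Functional)
    (hcoef : OddSingular.Coefficients n q₀ q p) :
    ∃ (K : ℝ → ℝ → ℂ) (B : OddSingular.Linf →L[ℂ] OddSingular.Linf) (u : ℕ → ℝ → ℂ) (a : ℝ → ℝ),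
      -- `B` is a bijection of `L_∞(0,1)` and `B f = 2 i q_0 f + ∫_0^x K(x,t) f(t) dt`
      Function.Bijective B ∧
      (∀ f : OddSingular.Linf, ∀ᵐ x ∂OddSingular.mu,
        B f x = 2 * Complex.I * q₀ x * f x + ∫ t in (0 : ℝ)..x, K x t * f t) ∧
      -- the kernel is dominated by a summable function of `t`
      Integrable a OddSingular.mu ∧
      (∀ x ∈ Icc (0 : ℝ) 1, IntegrableOn (K x) (Icc 0 x)) ∧
      (∀ x ∈ Icc (0 : ℝ) 1, ∀ t ∈ Icc 0 x, ‖K x t‖ ≤ a t) ∧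
      -- the functions `u_ν` belong to `W_1^1`
      (∀ ν < n, OddSingular.MemW 1 1 (u ν)) ∧
      -- the representation of the expression for every `y ∈ W_∞^n`
      (∀ (y : ℝ → ℂ) (hy : OddSingular.MemW ∞ n y),
        OddSingular.IsGenDeriv ∞ (n + 1)
          (fun x => B (hy.2.toLp (OddSingular.d^[n] y)) x
            + ∑ ν ∈ Finset.range n, (OddSingular.d^[ν] y) 0 * u ν x)
          (OddSingular.ell n q₀ q p y)) ∧
      -- the explicit formula for the kernel, for every choice of the primitives
      (∀ P Q : ℕ → ℝ → ℂ, OddSingular.Primitives n q₀ q p P Q →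
        ∀ᵐ t ∂OddSingular.mu, ∀ x ∈ Icc t 1, K x t = OddSingular.kernel n P Q x t) := by
  obtain ⟨P, Q, hPQ⟩ := hcoef.exists_primitives
  have hc : ∀ k ≤ n, ∀ ν, Integrable (coef P Q k ν) mu :=
    fun k hk ν => hPQ.integrable_coef hcoef.q_zero hk ν
  have hm : ContinuousOn (fun x => 2 * Complex.I * q₀ x) (Icc 0 1) :=
    continuousOn_const.mul (hcoef.q_zero.continuousOn (j := 0) zero_lt_one)
  obtain ⟨B, hB1, hB2⟩ := exists_bijective_volterra hm
    (fun x hx => mul_ne_zero (by simp) (hcoef.q_zero_ne x hx)) (integrable_kernelBound hc)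
    kernelBound_nonneg (fun x hx t ht => norm_kernel_le hc hx ht)
    (fun f hf x hx => integrableOn_kernel_mul hc hf hx)
    (fun f hf => continuousOn_integral_kernel hc hf)
  -- `u_μ` is the image under `transfer` of the polynomials that multiply `y^(μ)(0)` in the Taylor
  -- expansions of all the `y^(n-j)`.
  refine ⟨kernel n P Q, B, fun μ => transfer n P Q (taylorPoly n μ), kernelBound n P Q, hB1, hB2,
    integrable_kernelBound hc, fun x hx => integrableOn_kernel hc hx,
    fun x hx t ht => norm_kernel_le hc hx ht,
    fun μ _ => (isPrimitive_transfer hc fun j _ => memLp_taylorPoly n μ j).memW,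
    fun y hy φ hφ => ?_, fun P' Q' hPQ' => ae_forall_kernel_eq hcoef.q_zero hPQ hPQ'⟩
  rw [conjExponent_top] at hφ
  rw [ell_apply hcoef.q_zero hPQ hy hφ]
  refine congrArg _ (integral_congr_ae ?_)
  filter_upwards [hB2 (hy.2.toLp (d^[n] y)), hy.2.coeFn_toLp, ae_mu_mem_Icc] with x h1 h2 hx
  have h3 : ∫ t in (0 : ℝ)..x, kernel n P Q x t * hy.2.toLp (d^[n] y) t =
      ∫ t in (0 : ℝ)..x, kernel n P Q x t * d^[n] y t := by
    refine intervalIntegral.integral_congr_ae ?_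
    filter_upwards [ae_mu_iff.1 hy.2.coeFn_toLp] with t ht h4
    rw [uIoc_of_le hx.1] at h4
    rw [ht ⟨h4.1.le, h4.2.trans hx.2⟩]
  rw [h1, h2, h3, transfer_eq_add_initial hc hy hx, transfer_eq_integral_kernel hc hy.2 hx,
    ← add_assoc]
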